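/- **Notation.** Let $C_0^\infty(\mathbb R_+)$ be the space of smooth complex functions with compact support in $(0,\infty)$, and $C_0^\infty(\mathbb R_+)'$ the space of distributions on $(0,\infty)$; $\langle\cdot,\cdot\rangle$ denotes the complex-bilinear duality pairing. For $F,f,g\in C_0^\infty(\mathbb R_+)$ put $(\mathsf L F)(\lambda)=\int_0^\infty e^{-t\lambda}F(t)\,dt$ and $(f\star g)(t)=\int_0^t f(s)g(t-s)\,ds$. Let $h\in C_0^\infty(\mathbb R_+)'$ be real, i.e. $\langle h,\bar F\rangle=\overline{\langle h,F\rangle}$. Then $N_+(h)$ (resp. $N_-(h)$) is the maximal dimension of complex linear subspaces $\mathcal M\subset C_0^\infty(\mathbb R_+)$ such that $\langle h,\bar f\star f\rangle>0$ (resp. $<0$) for all $f\in\mathcal M$, $f\ne0$. A tempered distribution $\sigma$ on $\mathbb R$ with support in $[0,\infty)$ is the sigma-function of $h$ if $\langle h,F\rangle=\langle\sigma,\mathsf LF\rangle$ for all $F\in C_0^\infty(\mathbb R_+)$; here $\langle \sigma,\mathsf LF\rangle$ means $\langle\sigma,u\rangle$ for any Schwartz function $u$ equal to $\mathsf LF$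 on a neighbourhood of $[0,\infty)$. **Theorem.** Let $n\in\{0,1,2,\dots\}$, $k\in(n,n+1)$, $r\ge0$, $\alpha>0$. Let $h\in C_0^\infty(\mathbb R_+)'$ be real, and let $\sigma$ be its sigma-function. Suppose that away from the point $\alpha$ the distribution $\sigma$ coincides with a real function $\sigma(\lambda)$ which vanishes for $\lambda\le 0$, is continuous on $(0,\infty)\setminus\{\alpha\}$, and is bounded as $\lambda\to0^+$ and as $\lambda\to+\infty$; that $(\lambda-\alpha)^{n+1}\sigma(\lambda)\in L^1_{\rm loc}(\mathbb R_+)$; and that $$(-1)^{n+1}\sigma(\lambda)\ge0,\qquad \lambda>0,\ \lambda\ne\alpha .$$ Suppose also that $\sigma=\sigma_0+\tilde\sigma$, where $$\sigma_0(\lambda)=\frac1{\Gamma(-k)}(\lambda-\alpha)_+^{-k-1}e^{-r(\lambda-\alpha)},$$ that is, with $v(\lambda)=e^{-r(\lambda-\alpha)}u(\lambda)$, $$\langle\sigma_0,u\rangle=\frac1{\Gamma(-k)}\int_\alpha^\infty(\lambda-\alpha)^{-k-1}\Big(v(\lambda)-\sum_{p=0}^n\frac{v^{(p)}(\alpha)}{p!}(\lambda-\alpha)^p\Big)d\lambda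 ,$$ and where $\tilde\sigma$ satisfies: for $\varphi_\varepsilon(\lambda)=\omega((\lambda-\alpha)/\varepsilon)$ with $\omega\in C_0^\infty(\mathbb R)$, $$\langle\tilde\sigma,\varphi_\varepsilon\rangle=o(\varepsilon^{-k})\quad(\varepsilon\to0^+),$$ uniformly over functions $\omega$ with support in a common compact set and with uniformly bounded $C^n$-norms. Then $N_+(h)=n/2+1$ if $n$ is even, and $N_-(h)=(n+1)/2$ if $n$ is odd. -/

import Mathlib

open Set Filter Topology MeasureTheory
open scoped Distributions SchwartzMap

noncomputable section

namespace Hankel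

/-- The open half-line `(0, ∞)`. -/
def halfLine : TopologicalSpace.Opens ℝ := ⟨Ioi 0, isOpen_Ioi⟩

/-- Smooth complex functions with compact support in `(0, ∞)`. -/
abbrev Test : Type := 𝓓(halfLine, ℂ)

/-- Distributions on `(0, ∞)`: continuous complex-linear functionals on the LF space `Test`. -/
abbrev Dist : Type := Test →L[ℂ] ℂ

/-- The pointwise complex conjugate of a test function. -/
def conjTest (f : Test) : Test where
  toFun t := starRingEnd ℂ (f t)
  contDiff' := Complex.conjCLE.contDiff.comp f.contDiff
  hasCompactSupport' := f.hasCompactSupport.comp_left (g := starRingEnd ℂ) (map_zero _)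
  tsupport_subset' :=
    (closure_mono (Function.support_comp_subset (g := starRingEnd ℂ) (map_zero _) f)).trans
      f.tsupport_subset

theorem test_eq_zero (f : Test) {t : ℝ} (ht : t ≤ 0) : f t = 0 := by
  by_contra h
  have h1 : t ∈ (halfLine : Set ℝ) := f.tsupport_subset (subset_tsupport _ h)
  exact absurd h1 (not_lt.2 ht)

theorem laplaceConv_eq (f g : Test) :
    (fun t : ℝ => ∫ s in (0 : ℝ)..t, f s * g (t - s)) =
      MeasureTheory.convolution f g (ContinuousLinearMap.mul ℝ ℂ) volume := by
  funext t
  rw [MeasureTheory.convolution_def]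
  simp only [ContinuousLinearMap.mul_apply']
  rcases le_total 0 t with ht | ht
  · rw [intervalIntegral.integral_of_le ht]
    refine setIntegral_eq_integral_of_forall_compl_eq_zero fun s hs => ?_
    rcases le_or_gt s 0 with h0 | h0
    · rw [test_eq_zero f h0, zero_mul]
    · have h1 : t - s ≤ 0 := by
        by_contra h2
        exact hs ⟨h0, by linarith⟩
      rw [test_eq_zero g h1, mul_zero]
  · have h1 : (fun s : ℝ => f s * g (t - s)) = fun _ => 0 := by
      funext s
      rcases le_or_gt s 0 with h0 | h0
      · rw [test_eq_zero f h0, zero_mul]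
      · rw [test_eq_zero g (by linarith : t - s ≤ 0), mul_zero]
    simp [h1]

open scoped Pointwise in
/-- The Laplace convolution `(f ⋆ g)(t) = ∫₀ᵗ f(s) g(t - s) ds`. -/
def laplaceConv (f g : Test) : Test where
  toFun t := ∫ s in (0 : ℝ)..t, f s * g (t - s)
  contDiff' := by
    rw [laplaceConv_eq]
    exact g.hasCompactSupport.contDiff_convolution_right _
      (f.continuous.locallyIntegrable) g.contDiff
  hasCompactSupport' := by
    rw [laplaceConv_eq]
    exact f.hasCompactSupport.convolution _ g.hasCompactSupport
  tsupport_subset' := by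
    rw [laplaceConv_eq]
    have hc : IsCompact (tsupport f + tsupport g) :=
      f.hasCompactSupport.isCompact.add g.hasCompactSupport.isCompact
    have h1 := closure_minimal ((support_convolution_subset (ContinuousLinearMap.mul ℝ ℂ)
      (μ := volume) (f := f) (g := g)).trans
      (add_subset_add (subset_tsupport _) (subset_tsupport _))) hc.isClosed
    refine h1.trans ?_
    rintro _ ⟨x, hx, y, hy, rfl⟩
    have hx' : (0 : ℝ) < x := f.tsupport_subset hx
    have hy' : (0 : ℝ) < y := g.tsupport_subset hy
    exact add_pos hx' hy'

/-- `h` is real: `⟨h, F̄⟩` is the conjugate of `⟨h, F⟩`. -/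
def IsReal (h : Dist) : Prop := ∀ F : Test, h (conjTest F) = starRingEnd ℂ (h F)

/-- The Hankel quadratic form `⟨h, f̄ ⋆ f⟩`; for real `h` its values are real numbers. -/
def hankelForm (h : Dist) (f : Test) : ℝ := (h (laplaceConv (conjTest f) f)).re

/-- The maximal dimension of complex linear subspaces on which `q` is strictly positive away
from the zero vector (`⊤` if there are such subspaces of arbitrarily large dimension). -/
def posIndex {V : Type*} [AddCommGroup V] [Module ℂ V] (q : V → ℝ) : ℕ∞ :=
  ⨆ (M : Submodule ℂ V) (_ : ∀ v ∈ M, v ≠ 0 → 0 < q v), Cardinal.toENat (Module.rank ℂ M)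

/-- `N₊(h)`, the number of positive squares of the Hankel form on `C₀^∞(0, ∞)`. -/
def Nplus (h : Dist) : ℕ∞ := posIndex (hankelForm h)

/-- `N₋(h)`, the number of negative squares of the Hankel form on `C₀^∞(0, ∞)`. -/
def Nminus (h : Dist) : ℕ∞ := posIndex (fun f => -hankelForm h f)

/-- The Laplace transform `(L F)(x) = ∫₀^∞ e^{-tx} F(t) dt` on the real line. -/
def laplace (F : Test) (x : ℝ) : ℂ := ∫ t in Ioi (0 : ℝ), (Real.exp (-(t * x)) : ℂ) * F t

/-- `σ` is the sigma-function of the kernel `h`, that is `h = L* σ`, or `⟨h, F⟩ = ⟨σ, L F⟩` for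
every test function `F`. The notion is used for tempered distributions `σ` on `ℝ` with support
in `[0, ∞)`; as `L F` is an entire function that decays exponentially at `+∞` (but may grow at
`-∞`), `⟨σ, L F⟩` is the value of `σ` on any Schwartz function that coincides with `L F` on a
neighbourhood of `[0, ∞)`. -/
def IsSigmaFunction (h : Dist) (σ : 𝓢'(ℝ, ℂ)) : Prop :=
  ∀ (F : Test) (u : 𝓢(ℝ, ℂ)), (∃ δ > 0, ∀ x : ℝ, -δ < x → u x = laplace F x) → h F = σ u

/-- Away from the point `α`, the distribution `σ` coincides with the function equal to `s` on
`(0, ∞)` and to `0` on `(-∞, 0]`. In particular the support of `σ` is contained in `[0, ∞)`. -/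
def EqFunctionAwayFrom (σ : 𝓢'(ℝ, ℂ)) (s : ℝ → ℝ) (α : ℝ) : Prop :=
  ∀ u : 𝓢(ℝ, ℂ), α ∉ tsupport u → σ u = ∫ x in Ioi (0 : ℝ), (s x : ℂ) * u x

/-- The value at `u` of the distribution `(x - α)₊^{-k-1} e^{-r(x-α)} / Γ(-k)`, `n < k < n + 1`:
with `v(x) = e^{-r(x-α)} u(x)` it is
`Γ(-k)⁻¹ ∫_α^∞ (x-α)^{-k-1} (v(x) - ∑_{p ≤ n} v^{(p)}(α) (x-α)^p / p!) dx`. -/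
def sigmaZero (n : ℕ) (k r α : ℝ) (u : 𝓢(ℝ, ℂ)) : ℂ :=
  let v : ℝ → ℂ := fun x => (Real.exp (-(r * (x - α))) : ℂ) * u x
  (1 / Real.Gamma (-k) : ℂ) * ∫ x in Ioi α, (((x - α) ^ (-k - 1) : ℝ) : ℂ) *
    (v x - ∑ p ∈ Finset.range (n + 1),
      iteratedDeriv p v α / (p.factorial : ℂ) * ((x - α : ℝ) : ℂ) ^ p)

/-- `⟨τ, ω((· - α)/ε)⟩ = o(ε^{-k})` as `ε → 0+`, uniformly in smooth `ω` with support in a fixed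
compact set and bounded `C^n`-norm. -/
def LessSingular (τ : 𝓢'(ℝ, ℂ)) (n : ℕ) (k α : ℝ) : Prop :=
  ∀ R M η : ℝ, 0 < η → ∃ ε₀ > 0, ∀ ε : ℝ, 0 < ε → ε < ε₀ →
    ∀ ω : ℝ → ℂ, ContDiff ℝ ((⊤ : ℕ∞) : WithTop ℕ∞) ω → tsupport ω ⊆ Icc (-R) R →
      (∀ p ≤ n, ∀ x, ‖iteratedDeriv p ω x‖ ≤ M) →
      ∀ φ : 𝓢(ℝ, ℂ), (∀ x, φ x = ω ((x - α) / ε)) → ‖τ φ‖ ≤ η * ε ^ (-k)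

end Hankel

end

/-! The Laplace transform turns `⋆` into a product, so the Hankel form is `⟨σ, |Lf|²⟩`. Multiplying
it by `(-1)^n` merges the two parities: `PointSingularity.posIndex_eq` says that the index of
positivity of the resulting form is `n / 2 + 1` (integer division).

Upper bound. The regularization in `σ₀` subtracts only the `n`-jet at `α`, and `τ` is less singular
than `σ₀`. Hence on functions that are `O((x - α)^(n+1))` the distribution `σ` is plain integration
against `s` (`PointSingularity.eq_integral`): such a function cut off to the scale `ε` around `α`
contributes nothing in the limit. If the first `n / 2 + 1` Taylor coefficients of `Lf` at `α`
vanish, then `|Lf|²` has a zero of order at least `n + 1`, the form equals `∫ s |Lf|²`, and the sign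
condition on `s` gives `PointSingularity.hankelForm_nonpos`. So only `n / 2 + 1` linear conditions
have to be imposed to lose positivity.

Lower bound. Take the functions `e^{r(x-α)/2} y^i χ(y)`, `y = (x - α)/ε`, `i ≤ n / 2`. The
exponential cancels the one in `σ₀`, and `y^(i+j)` is its own Taylor polynomial because `i + j ≤ n`.
Therefore `ε^k ⟨σ, ·⟩` of a product tends to `Γ(-k)⁻¹ ∫₀^∞ y^(i+j-k-1) (χ² - 1) dy`
(`PointSingularity.tendsto_trialProduct`). As `χ² ≤ 1`, this moment matrix is negative definite
(`sum_moment_neg`), while `Γ(-k)` has the sign `(-1)^(n+1)`; so `(-1)^n` times the limit matrix is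
positive definite. The trial functions are not Laplace transforms of test functions. They are
approximated by such transforms with contact of order `n + 1` at `α` (`exists_laplace_near`), so
that the error in the products is again integrated against `s` and is small
(`PointSingularity.exists_test_near`). Positive definiteness survives the perturbation
(`exists_perturbation_pos`). -/

namespace Hankel

open scoped ContDiff

/-! ### Jets and Taylor bounds at a point -/

section Jets

theorem differentiable_iteratedDeriv_of_smooth {u : ℝ → ℂ} (hu : ContDiff ℝ ∞ u) (q : ℕ) :
    Differentiable ℝ (iteratedDeriv q u) :=
  (hu.of_le (show ((q + 1 : ℕ) : WithTop ℕ∞) ≤ ∞ by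
    exact_mod_cast le_top)).differentiable_iteratedDeriv q (by exact_mod_cast Nat.lt_succ_self q)

/-- A smooth function that is `O((x - α)^(n+1))` at `α` has vanishing jet of order `n`. -/
theorem iteratedDeriv_eq_zero_of_isBigO {u : ℝ → ℂ} {α : ℝ} {n : ℕ} (hu : ContDiff ℝ ∞ u)
    (h : u =O[𝓝 α] fun x => (x - α) ^ (n + 1)) : ∀ p ≤ n, iteratedDeriv p u α = 0 := by
  intro p
  induction p using Nat.strong_induction_on with
  | _ p ih =>
    intro hp
    -- By induction the Taylor polynomial of order `p` is its top term alone. Both `u` and the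
    -- Taylor remainder are `o((x - α)^p)`, hence so is that term, and its coefficient must be zero.
    have h1 : (fun x => u x - taylorWithinEval u p univ α x) =o[𝓝 α] fun x => (x - α) ^ p :=
      taylor_isLittleO_univ (hu.of_le (by exact_mod_cast le_top))
    have h2 : ∀ x, taylorWithinEval u p univ α x =
        (((p.factorial : ℝ))⁻¹ * (x - α) ^ p) • iteratedDeriv p u α := by
      intro x
      rw [taylor_within_apply, Finset.sum_range_succ, Finset.sum_eq_zero, zero_add,
        iteratedDerivWithin_univ]
      intro q hq
      have hq' := Finset.mem_range.1 hq
      rw [iteratedDerivWithin_univ, ih q hq' (by omega), smul_zero]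
    have ht : Tendsto (fun x : ℝ => x - α) (𝓝 α) (𝓝 0) := by
      have : Tendsto (fun x : ℝ => x - α) (𝓝 α) (𝓝 (α - α)) := tendsto_id.sub_const α
      simpa using this
    have h3 : u =o[𝓝 α] fun x => (x - α) ^ p := by
      refine h.trans_isLittleO ?_
      have : (fun y : ℝ => y ^ (n + 1)) =o[𝓝 0] fun y : ℝ => y ^ p :=
        Asymptotics.isLittleO_pow_pow (by omega)
      exact this.comp_tendsto ht
    have h4 : (fun x : ℝ => (((p.factorial : ℝ))⁻¹ * (x - α) ^ p) • iteratedDeriv p u α)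
        =o[𝓝 α] fun x => (x - α) ^ p := by
      refine (h3.sub h1).congr_left fun x => ?_
      rw [h2]; ring
    by_contra hne
    have hpos : 0 < ‖iteratedDeriv p u α‖ := norm_pos_iff.2 hne
    have hfac : (0 : ℝ) < ((p.factorial : ℝ))⁻¹ := by positivity
    have h5 := h4.def (c := (((p.factorial : ℝ))⁻¹ * ‖iteratedDeriv p u α‖) / 2) (by positivity)
    have h6 : ∃ᶠ x in 𝓝 α, x ≠ α := by
      have : (𝓝[≠] α).NeBot := inferInstance
      exact (frequently_mem_iff_neBot (s := {α}ᶜ)).2 this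
    obtain ⟨x, hx, hxα⟩ := (h6.and_eventually h5).exists
    have h7 : 0 < |x - α| ^ p := pow_pos (abs_pos.2 (sub_ne_zero.2 hx)) p
    rw [norm_smul, norm_mul, norm_pow, Real.norm_eq_abs, Real.norm_eq_abs, abs_of_pos hfac] at hxα
    have h8 : 0 < ((p.factorial : ℝ))⁻¹ * ‖iteratedDeriv p u α‖ * |x - α| ^ p := by positivity
    linarith

/-- Taylor bounds for the derivatives of a smooth function with vanishing jet of order `n`. -/
theorem exists_norm_iteratedDeriv_le {u : ℝ → ℂ} {α : ℝ} {n : ℕ} (hu : ContDiff ℝ ∞ u)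
    (h : ∀ p ≤ n, iteratedDeriv p u α = 0) :
    ∃ C, 0 ≤ C ∧ ∀ p ≤ n + 1, ∀ x, |x - α| ≤ 1 →
      ‖iteratedDeriv p u x‖ ≤ C * |x - α| ^ (n + 1 - p) := by
  have hcont : Continuous (iteratedDeriv (n + 1) u) :=
    hu.continuous_iteratedDeriv _ (by exact_mod_cast le_top)
  obtain ⟨C, hC⟩ := (isCompact_closedBall α (1 : ℝ)).exists_bound_of_continuousOn
    hcont.continuousOn
  have hC0 : 0 ≤ C := (norm_nonneg _).trans (hC α (by simp))
  refine ⟨C, hC0, ?_⟩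
  -- Induction downwards from the derivative of order `n + 1`: each step applies the mean value
  -- inequality on the ball of radius `|x - α|` and gains one power.
  have key : ∀ j ≤ n + 1, ∀ x, |x - α| ≤ 1 →
      ‖iteratedDeriv (n + 1 - j) u x‖ ≤ C * |x - α| ^ j := by
    intro j
    induction j with
    | zero =>
      intro _ x hx
      simpa using hC x (by simpa [Real.dist_eq] using hx)
    | succ j ih =>
      intro hj x hx
      have e : n + 1 - j = (n + 1 - (j + 1)) + 1 := by omega
      have hd : Differentiable ℝ (iteratedDeriv (n + 1 - (j + 1)) u) :=
        differentiable_iteratedDeriv_of_smooth hu _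
      have h1 := Convex.norm_image_sub_le_of_norm_deriv_le (𝕜 := ℝ)
        (f := iteratedDeriv (n + 1 - (j + 1)) u) (s := Metric.closedBall α |x - α|)
        (C := C * |x - α| ^ j) (x := α) (y := x) (fun y _ => hd y)
        (fun y hy => by
          have hy' : |y - α| ≤ |x - α| := by simpa [Real.dist_eq] using hy
          rw [← iteratedDeriv_succ, ← e]
          refine (ih (by omega) y (hy'.trans hx)).trans ?_
          gcongr) (convex_closedBall _ _) (by simp) (by simp [Real.dist_eq])
      rw [h _ (by omega), sub_zero] at h1
      rwa [pow_succ, ← mul_assoc]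
  intro p hp x hx
  have := key (n + 1 - p) (by omega) x hx
  rwa [show n + 1 - (n + 1 - p) = p by omega] at this

theorem isBigO_of_iteratedDeriv_eq_zero {u : ℝ → ℂ} {α : ℝ} {m : ℕ} (hu : ContDiff ℝ ∞ u)
    (h : ∀ p < m, iteratedDeriv p u α = 0) : u =O[𝓝 α] fun x => (x - α) ^ m := by
  rcases m with _ | n
  · simpa using (hu.continuous.tendsto α).isBigO_one ℝ
  · obtain ⟨C, -, hC⟩ := exists_norm_iteratedDeriv_le hu (n := n) (fun p hp => h p (by omega))
    refine Asymptotics.IsBigO.of_bound C ?_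
    filter_upwards [Metric.closedBall_mem_nhds α one_pos] with x hx
    have := hC 0 (by omega) x (by simpa [Real.dist_eq] using hx)
    simpa using this

/-- Leibniz bound for the derivatives of a product. -/
theorem norm_iteratedDeriv_mul_le_of_le {f g : ℝ → ℂ} (hf : ContDiff ℝ ∞ f) (hg : ContDiff ℝ ∞ g)
    {n : ℕ} {x A B : ℝ} (hA : ∀ p ≤ n, ‖iteratedDeriv p f x‖ ≤ A)
    (hB : ∀ p ≤ n, ‖iteratedDeriv p g x‖ ≤ B) :
    ∀ p ≤ n, ‖iteratedDeriv p (fun y => f y * g y) x‖ ≤ 2 ^ n * (A * B) := by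
  intro p hp
  have hA0 : 0 ≤ A := (norm_nonneg _).trans (hA 0 (by omega))
  have hB0 : 0 ≤ B := (norm_nonneg _).trans (hB 0 (by omega))
  have h1 := norm_iteratedFDeriv_mul_le hf hg x (n := p) (by exact_mod_cast le_top)
  simp only [norm_iteratedFDeriv_eq_norm_iteratedDeriv] at h1
  refine h1.trans ?_
  calc ∑ i ∈ Finset.range (p + 1), (p.choose i : ℝ) * ‖iteratedDeriv i f x‖ *
        ‖iteratedDeriv (p - i) g x‖
      ≤ ∑ i ∈ Finset.range (p + 1), (p.choose i : ℝ) * (A * B) := by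
        refine Finset.sum_le_sum fun i hi => ?_
        have hi' := Finset.mem_range.1 hi
        rw [mul_assoc]
        gcongr
        · exact hA i (by omega)
        · exact hB _ (by omega)
    _ = 2 ^ p * (A * B) := by
        rw [← Finset.sum_mul]
        congr 1
        exact_mod_cast Nat.sum_range_choose p
    _ ≤ 2 ^ n * (A * B) := by
        gcongr
        norm_num

theorem iteratedDeriv_comp_affine {f : ℝ → ℂ} (hf : ContDiff ℝ ∞ f) (p : ℕ) (a ε y : ℝ) :
    iteratedDeriv p (fun y => f (a + ε * y)) y = (ε : ℂ) ^ p * iteratedDeriv p f (a + ε * y) := by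
  have h1 : ContDiff ℝ p (fun y => f (a + y)) :=
    (hf.comp (contDiff_const.add contDiff_id)).of_le (by exact_mod_cast le_top)
  have h2 := congrFun (iteratedDeriv_comp_const_smul h1 ε) y
  rw [iteratedDeriv_comp_const_add] at h2
  simpa using h2

end Jets

/-! ### Integrability of `s` against a weight vanishing at `α` -/

/-- The standing hypotheses on a sigma-function `σ` that is a function `s` away from `α` and has
leading singularity `(x - α)₊^{-k-1} / Γ(-k)` at `α`. -/
structure PointSingularity (n : ℕ) (k r α : ℝ) (σ τ : 𝓢'(ℝ, ℂ)) (s : ℝ → ℝ) : Prop where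
  lt_order : (n : ℝ) < k
  order_lt : k < n + 1
  nonneg_rate : 0 ≤ r
  pos_point : 0 < α
  eq_function : EqFunctionAwayFrom σ s α
  continuousOn : ContinuousOn s (Ioi 0 \ {α})
  isBigO_zero : s =O[𝓝[>] 0] fun _ => (1 : ℝ)
  isBigO_atTop : s =O[atTop] fun _ => (1 : ℝ)
  locallyIntegrableOn : LocallyIntegrableOn (fun x => (x - α) ^ (n + 1) * s x) (Ioi 0)
  decomp : ∀ u : 𝓢(ℝ, ℂ), σ u = sigmaZero n k r α u + τ u
  lessSingular : LessSingular τ n k α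

/-- The weight `|x - α|^(n+1) (1 + |x|)^{-(n+3)}` against which `s` is integrable. -/
noncomputable def weight (n : ℕ) (α x : ℝ) : ℝ := |x - α| ^ (n + 1) * ((1 + |x|) ^ (n + 3))⁻¹

theorem weight_nonneg (n : ℕ) (α x : ℝ) : 0 ≤ weight n α x := by
  unfold weight; positivity

theorem weight_le_pow (n : ℕ) (α x : ℝ) : weight n α x ≤ |x - α| ^ (n + 1) := by
  unfold weight
  refine mul_le_of_le_one_right (by positivity) (inv_le_one_of_one_le₀ ?_)
  exact one_le_pow₀ (by linarith [abs_nonneg x])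

/-- The numerator uses up `n + 1` of the `n + 3` powers in the denominator; the remaining two make
the weight integrable where `s` is merely bounded. -/
theorem weight_le_sq (n : ℕ) (α x : ℝ) :
    weight n α x ≤ (1 + |α|) ^ (n + 1) * ((1 + |x|) ^ 2)⁻¹ := by
  unfold weight
  have h1 : |x - α| ≤ (1 + |α|) * (1 + |x|) := by
    nlinarith [abs_sub x α, abs_nonneg x, abs_nonneg α, mul_nonneg (abs_nonneg x) (abs_nonneg α)]
  have h2 : 0 < 1 + |x| := by positivity
  calc |x - α| ^ (n + 1) * ((1 + |x|) ^ (n + 3))⁻¹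
      ≤ ((1 + |α|) * (1 + |x|)) ^ (n + 1) * ((1 + |x|) ^ (n + 3))⁻¹ := by gcongr
    _ = _ := by
      rw [mul_pow, show n + 3 = (n + 1) + 2 by ring, pow_add _ (n + 1) 2]
      field_simp

theorem exists_decay (u : 𝓢(ℝ, ℂ)) (N : ℕ) :
    ∃ C, 0 ≤ C ∧ ∀ x, ‖u x‖ ≤ C * ((1 + |x|) ^ N)⁻¹ := by
  refine ⟨2 ^ N * ((Finset.Iic (N, 0)).sup fun m => SchwartzMap.seminorm ℝ m.1 m.2) u,
    by positivity, fun x => ?_⟩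
  · have h := SchwartzMap.one_add_le_sup_seminorm_apply (𝕜 := ℝ) (m := (N, 0)) (k := N) (n := 0)
      le_rfl le_rfl u x
    rw [norm_iteratedFDeriv_zero, Real.norm_eq_abs] at h
    rw [← div_eq_mul_inv, le_div_iff₀ (by positivity), mul_comm]
    exact h

/-- Within `δ` of `α` the contact gives the bound, the denominator of the weight being bounded
there; farther away Schwartz decay suffices, since `|x - α|^(n+1) ≥ δ^(n+1)`. -/
theorem exists_norm_le_weight {n : ℕ} {α : ℝ} (u : 𝓢(ℝ, ℂ))
    (hu : u =O[𝓝 α] fun x => (x - α) ^ (n + 1)) :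
    ∃ K, 0 ≤ K ∧ ∀ x, ‖u x‖ ≤ K * weight n α x := by
  obtain ⟨C₁, hC₁⟩ := hu.bound
  obtain ⟨δ, hδ, hball⟩ := Metric.eventually_nhds_iff.1 hC₁
  obtain ⟨C₂, hC₂0, hC₂⟩ := exists_decay u (n + 3)
  refine ⟨|C₁| * (1 + (|α| + δ)) ^ (n + 3) + C₂ * (δ ^ (n + 1))⁻¹, by positivity, fun x => ?_⟩
  have hp : 0 < (1 + |x|) ^ (n + 3) := by positivity
  rw [add_mul]
  rcases lt_or_ge |x - α| δ with hx | hx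
  · have h1 := hball (y := x) (by rwa [Real.dist_eq])
    have hxx : |x| ≤ |α| + δ := by
      have := abs_sub_abs_le_abs_sub x α
      linarith
    refine le_add_of_le_of_nonneg ?_ (mul_nonneg (by positivity) (weight_nonneg _ _ _))
    rw [norm_pow, Real.norm_eq_abs] at h1
    calc ‖u x‖ ≤ |C₁| * |x - α| ^ (n + 1) * 1 := by
          rw [mul_one]; exact h1.trans (by gcongr; exact le_abs_self _)
      _ ≤ |C₁| * |x - α| ^ (n + 1) * ((1 + (|α| + δ)) ^ (n + 3) * ((1 + |x|) ^ (n + 3))⁻¹) := by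
          gcongr
          rw [← div_eq_mul_inv, one_le_div hp]
          gcongr
      _ = _ := by unfold weight; ring
  · refine le_add_of_nonneg_of_le (mul_nonneg (by positivity) (weight_nonneg _ _ _)) ?_
    calc ‖u x‖ ≤ C₂ * ((1 + |x|) ^ (n + 3))⁻¹ * 1 := by rw [mul_one]; exact hC₂ x
      _ ≤ C₂ * ((1 + |x|) ^ (n + 3))⁻¹ * (|x - α| ^ (n + 1) * (δ ^ (n + 1))⁻¹) := by
          gcongr
          rw [← div_eq_mul_inv, one_le_div (by positivity)]
          gcongr
      _ = _ := by unfold weight; ring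

section

variable {n : ℕ} {k r α : ℝ} {σ τ : 𝓢'(ℝ, ℂ)} {s : ℝ → ℝ}

theorem PointSingularity.aestronglyMeasurable (H : PointSingularity n k r α σ τ s) :
    AEStronglyMeasurable s (volume.restrict (Ioi 0)) := by
  have h := H.continuousOn.aestronglyMeasurable (μ := volume)
    (measurableSet_Ioi.diff (measurableSet_singleton α))
  rwa [Measure.restrict_congr_set (sdiff_null_ae_eq_self (by simp))] at h

/-- Near `0` and near `∞` the function `s` is bounded and `weight_le_sq` applies. On the compact
interval in between the weight is at most `|x - α|^(n+1)`, and local integrability applies. -/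
theorem PointSingularity.integrableOn_weight (H : PointSingularity n k r α σ τ s) :
    IntegrableOn (fun x => s x * weight n α x) (Ioi 0) := by
  have hw : Continuous (weight n α) := by
    unfold weight
    refine Continuous.mul (by fun_prop) (Continuous.inv₀ (by fun_prop) fun x => ?_)
    positivity
  have hmeas : AEStronglyMeasurable (fun x => s x * weight n α x) (volume.restrict (Ioi 0)) :=
    H.aestronglyMeasurable.mul hw.aestronglyMeasurable
  obtain ⟨C₁, hC₁⟩ := H.isBigO_zero.bound
  obtain ⟨C₂, hC₂⟩ := H.isBigO_atTop.bound
  obtain ⟨a, ha, hCa⟩ := mem_nhdsGT_iff_exists_Ioo_subset.1 hC₁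
  obtain ⟨b, hb⟩ := eventually_atTop.1 hC₂
  have hdom : ∀ C, ∀ t ⊆ Ioi (0 : ℝ), MeasurableSet t → (∀ x ∈ t, ‖s x‖ ≤ C * ‖(1 : ℝ)‖) →
      IntegrableOn (fun x => s x * weight n α x) t := by
    intro C t ht htm hC
    have hint : Integrable (fun x : ℝ => |C| * ((1 + |α|) ^ (n + 1) * ((1 + |x|) ^ 2)⁻¹)) := by
      refine Integrable.const_mul (Integrable.const_mul ?_ _) _
      have := integrable_one_add_norm (E := ℝ) (μ := volume) (r := 2) (by simp)
      refine this.congr (ae_of_all _ fun x => ?_)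
      simp only [Real.norm_eq_abs]
      rw [Real.rpow_neg (by positivity)]
      norm_num
    refine Integrable.mono' hint.integrableOn (hmeas.mono_set ht) ?_
    refine (ae_restrict_iff' htm).2 (ae_of_all _ fun x hx => ?_)
    rw [norm_mul, Real.norm_of_nonneg (weight_nonneg n α x)]
    have := hC x hx
    rw [norm_one, mul_one] at this
    exact mul_le_mul (this.trans (le_abs_self _)) (weight_le_sq _ _ _) (weight_nonneg _ _ _)
      (abs_nonneg _)
  have ha' : 0 < a := ha
  have h1 := hdom C₁ (Ioo 0 a) (fun x hx => hx.1) measurableSet_Ioo fun x hx => hCa hx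
  have h2 := hdom C₂ (Ioi (max a b)) (fun x hx => ha'.trans (lt_of_le_of_lt (le_max_left _ _) hx))
    measurableSet_Ioi fun x hx => hb x ((le_max_right _ _).trans (le_of_lt hx))
  have h3 : IntegrableOn (fun x => s x * weight n α x) (Icc a (max a b)) := by
    have hsub : Icc a (max a b) ⊆ Ioi (0 : ℝ) := fun x hx => ha'.trans_le hx.1
    have h4 := H.locallyIntegrableOn.integrableOn_compact_subset hsub isCompact_Icc
    refine Integrable.mono h4 (hmeas.mono_set hsub) (ae_of_all _ fun x => ?_)
    rw [norm_mul, norm_mul, Real.norm_of_nonneg (weight_nonneg n α x), norm_pow,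
      Real.norm_eq_abs (x - α), mul_comm]
    gcongr
    exact weight_le_pow _ _ _
  refine ((h1.union h3).union h2).mono_set fun x hx => ?_
  rcases lt_or_ge x a with hxa | hxa
  · exact Or.inl (Or.inl ⟨hx, hxa⟩)
  · rcases le_or_gt x (max a b) with hxb | hxb
    · exact Or.inl (Or.inr ⟨hxa, hxb⟩)
    · exact Or.inr hxb

/-- A continuous function dominated by the weight is integrable against `s`, with a bound. -/
theorem PointSingularity.integrableOn_mul (H : PointSingularity n k r α σ τ s) {u : ℝ → ℂ}
    (hu : Continuous u) {K : ℝ} (hK : ∀ x, 0 < x → ‖u x‖ ≤ K * weight n α x) :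
    IntegrableOn (fun x => (s x : ℂ) * u x) (Ioi 0) ∧
      ‖∫ x in Ioi 0, (s x : ℂ) * u x‖ ≤ K * ∫ x in Ioi 0, |s x| * weight n α x := by
  have hb : IntegrableOn (fun x => K * (|s x| * weight n α x)) (Ioi 0) := by
    refine Integrable.const_mul ?_ _
    refine H.integrableOn_weight.norm.congr (ae_of_all _ fun x => ?_)
    simp only [norm_mul, Real.norm_eq_abs, abs_of_nonneg (weight_nonneg n α x)]
  have hle : ∀ᵐ x ∂volume.restrict (Ioi (0 : ℝ)),
      ‖(s x : ℂ) * u x‖ ≤ K * (|s x| * weight n α x) := by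
    refine (ae_restrict_iff' measurableSet_Ioi).2 (ae_of_all _ fun x hx => ?_)
    rw [norm_mul, Complex.norm_real, Real.norm_eq_abs]
    calc |s x| * ‖u x‖ ≤ |s x| * (K * weight n α x) := by gcongr; exact hK x hx
      _ = _ := by ring
  refine ⟨Integrable.mono' hb ?_ hle, ?_⟩
  · exact (Complex.continuous_ofReal.comp_aestronglyMeasurable H.aestronglyMeasurable).mul
      hu.aestronglyMeasurable
  · rw [← integral_const_mul]
    exact norm_integral_le_of_norm_le hb hle

end

/-! ### Cutoffs, and elementary properties of `τ` and `σ₀` -/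

/-- A smooth even cutoff, equal to `1` on `[-1, 1]` and supported in `[-2, 2]`. -/
noncomputable def cutoff (y : ℝ) : ℝ := (⟨1, 2, one_pos, one_lt_two⟩ : ContDiffBump (0 : ℝ)) y

theorem cutoff_contDiff : ContDiff ℝ ∞ cutoff := ContDiffBump.contDiff _

theorem cutoff_nonneg (y : ℝ) : 0 ≤ cutoff y := ContDiffBump.nonneg _

theorem cutoff_le_one (y : ℝ) : cutoff y ≤ 1 := ContDiffBump.le_one _

theorem cutoff_eq_one {y : ℝ} (hy : |y| ≤ 1) : cutoff y = 1 :=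
  ContDiffBump.one_of_mem_closedBall _ (by simpa using hy)

theorem cutoff_eq_zero {y : ℝ} (hy : 2 ≤ |y|) : cutoff y = 0 :=
  ContDiffBump.zero_of_le_dist _ (by simpa using hy)

theorem tsupport_subset_of_eq_zero {f : ℝ → ℂ} {R : ℝ} (hf : ∀ y, R ≤ |y| → f y = 0) :
    tsupport f ⊆ Icc (-R) R := by
  refine closure_minimal (fun y hy => ?_) isClosed_Icc
  by_contra h
  refine hy (hf y (le_of_not_ge fun h1 => h (abs_le.1 h1)))

theorem hasCompactSupport_of_eq_zero {f : ℝ → ℂ} {a R : ℝ} (hf : ∀ y, R ≤ |y - a| → f y = 0) :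
    HasCompactSupport f := by
  refine HasCompactSupport.intro (isCompact_closedBall a R) fun y hy => hf y ?_
  rw [Metric.mem_closedBall, Real.dist_eq, not_le] at hy
  exact hy.le

theorem cutoff_complex_contDiff : ContDiff ℝ ∞ fun y => (cutoff y : ℂ) :=
  Complex.ofRealCLM.contDiff.comp cutoff_contDiff

theorem exists_bound_iteratedDeriv {f : ℝ → ℂ} (hf : ContDiff ℝ ∞ f) (hc : HasCompactSupport f)
    (n : ℕ) : ∃ B, 0 ≤ B ∧ ∀ p ≤ n, ∀ x, ‖iteratedDeriv p f x‖ ≤ B := by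
  refine ⟨∑ p ∈ Finset.range (n + 1), SchwartzMap.seminorm ℝ 0 p (hc.toSchwartzMap hf),
    by positivity, fun p hp x => ?_⟩
  have h1 := (hc.toSchwartzMap hf).le_seminorm' ℝ 0 p x
  rw [pow_zero, one_mul] at h1
  refine h1.trans ?_
  exact Finset.single_le_sum
    (f := fun p => SchwartzMap.seminorm ℝ 0 p (hc.toSchwartzMap hf))
    (fun _ _ => by positivity) (Finset.mem_range.2 (by omega))

theorem iteratedDeriv_eq_zero_of_notMem_tsupport {f : ℝ → ℂ} {y : ℝ} (p : ℕ)
    (hy : y ∉ tsupport f) : iteratedDeriv p f y = 0 := by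
  have h : iteratedFDeriv ℝ p f y = 0 := by
    by_contra hne
    exact hy (support_iteratedFDeriv_subset (𝕜 := ℝ) p hne)
  rw [← norm_eq_zero, ← norm_iteratedFDeriv_eq_norm_iteratedDeriv, h, norm_zero]

/-- The profile `w ε` may vary with `ε`, thanks to the uniformity in `LessSingular`; both
applications need this. -/
theorem LessSingular.tendsto {τ : 𝓢'(ℝ, ℂ)} {n : ℕ} {k α R M : ℝ} (hτ : LessSingular τ n k α)
    (φ : ℝ → 𝓢(ℝ, ℂ)) (w : ℝ → ℝ → ℂ)
    (h : ∀ᶠ ε in 𝓝[>] (0 : ℝ), ContDiff ℝ ∞ (w ε) ∧ tsupport (w ε) ⊆ Icc (-R) R ∧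
      (∀ p ≤ n, ∀ x, ‖iteratedDeriv p (w ε) x‖ ≤ M) ∧ ∀ x, φ ε x = w ε ((x - α) / ε)) :
    Tendsto (fun ε => ((ε ^ k : ℝ) : ℂ) * τ (φ ε)) (𝓝[>] 0) (𝓝 0) := by
  rw [Metric.tendsto_nhds]
  intro η hη
  obtain ⟨ε₀, hε₀, H⟩ := hτ R M (η / 2) (by positivity)
  filter_upwards [h, Ioo_mem_nhdsGT hε₀] with ε h1 h2
  have h3 := H ε h2.1 h2.2 (w ε) h1.1 h1.2.1 h1.2.2.1 (φ ε) h1.2.2.2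
  have hpos : 0 < ε ^ k := Real.rpow_pos_of_pos h2.1 _
  rw [dist_zero_right, norm_mul, Complex.norm_real, Real.norm_of_nonneg hpos.le]
  calc ε ^ k * ‖τ (φ ε)‖ ≤ ε ^ k * (η / 2 * ε ^ (-k)) := by gcongr
    _ = η / 2 := by
      rw [Real.rpow_neg h2.1.le]; field_simp
    _ < η := by linarith

/-- The exponential factor does not affect the order of vanishing, so every term of the subtracted
Taylor polynomial is zero. -/
theorem sigmaZero_eq_integral {n : ℕ} {k r α : ℝ} (u : 𝓢(ℝ, ℂ))
    (hu : u =O[𝓝 α] fun x => (x - α) ^ (n + 1)) :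
    sigmaZero n k r α u = (1 / Real.Gamma (-k) : ℂ) * ∫ x in Ioi α,
      (((x - α) ^ (-k - 1) : ℝ) : ℂ) * ((Real.exp (-(r * (x - α))) : ℂ) * u x) := by
  have hv : ContDiff ℝ ∞ fun x => (Real.exp (-(r * (x - α))) : ℂ) * u x := by
    have h1 : ContDiff ℝ ∞ fun x : ℝ => Real.exp (-(r * (x - α))) := by fun_prop
    exact (Complex.ofRealCLM.contDiff.comp h1).mul (u.smooth ⊤)
  have hO : (fun x => (Real.exp (-(r * (x - α))) : ℂ) * u x) =O[𝓝 α]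
      fun x => (x - α) ^ (n + 1) := by
    have h1 : (fun x => (Real.exp (-(r * (x - α))) : ℂ)) =O[𝓝 α] fun _ => (1 : ℝ) := by
      have hc : Continuous fun x : ℝ => (Real.exp (-(r * (x - α))) : ℂ) := by fun_prop
      exact (hc.tendsto α).isBigO_one ℝ
    simpa using h1.mul hu
  have hz := iteratedDeriv_eq_zero_of_isBigO hv hO
  unfold sigmaZero
  simp only
  congr 2
  ext x
  rw [Finset.sum_eq_zero, sub_zero]
  intro p hp
  rw [hz p (by have := Finset.mem_range.1 hp; omega), zero_div, zero_mul]

/-! ### Localization at the scale `ε` -/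

section Localize

variable (α : ℝ) (u : 𝓢(ℝ, ℂ))

theorem localize_contDiff (ε : ℝ) : ContDiff ℝ ∞ fun x => u x * (cutoff ((x - α) / ε) : ℂ) :=
  (u.smooth ⊤).mul (cutoff_complex_contDiff.comp ((contDiff_id.sub contDiff_const).div_const ε))

theorem localize_eq_zero {ε : ℝ} (hε : 0 < ε) {x : ℝ} (hx : 2 * ε ≤ |x - α|) :
    u x * (cutoff ((x - α) / ε) : ℂ) = 0 := by
  rw [cutoff_eq_zero, Complex.ofReal_zero, mul_zero]
  rwa [abs_div, abs_of_pos hε, le_div_iff₀ hε]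

/-- The localization `u χ((x - α)/ε)` of a Schwartz function. -/
noncomputable def localize (ε : ℝ) (hε : 0 < ε) : 𝓢(ℝ, ℂ) :=
  (hasCompactSupport_of_eq_zero fun _ hx => localize_eq_zero α u hε hx).toSchwartzMap
    (localize_contDiff α u ε)

@[simp]
theorem localize_apply (ε : ℝ) (hε : 0 < ε) (x : ℝ) :
    localize α u ε hε x = u x * (cutoff ((x - α) / ε) : ℂ) := rfl

theorem norm_localize_le (ε : ℝ) (hε : 0 < ε) (x : ℝ) : ‖localize α u ε hε x‖ ≤ ‖u x‖ := by
  rw [localize_apply, norm_mul, Complex.norm_real, Real.norm_of_nonneg (cutoff_nonneg _)]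
  exact mul_le_of_le_one_right (norm_nonneg _) (cutoff_le_one _)

theorem notMem_tsupport_sub_localize (ε : ℝ) (hε : 0 < ε) :
    α ∉ tsupport (u - localize α u ε hε) := by
  rw [notMem_tsupport_iff_eventuallyEq]
  filter_upwards [Metric.closedBall_mem_nhds α hε] with x hx
  have hx' : |x - α| ≤ ε := by simpa [Real.dist_eq] using hx
  have : cutoff ((x - α) / ε) = 1 := cutoff_eq_one (by
    rwa [abs_div, abs_of_pos hε, div_le_one hε])
  simp [this]

end Localize

/-! ### Action of `σ` on functions with a zero of order `n + 1` -/

section Structure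

variable {n : ℕ} {k r α : ℝ} {σ τ : 𝓢'(ℝ, ℂ)} {s : ℝ → ℝ}

/-- In the variable `y = (x - α)/ε` the localized function is `ε^(n+1)` times a profile bounded in
`C^n`. So `τ` takes on it a value `o(ε^(n+1-k))`, and `k < n + 1`. -/
theorem PointSingularity.tendsto_lessSingular_localize (H : PointSingularity n k r α σ τ s)
    (u : 𝓢(ℝ, ℂ)) (hu : u =O[𝓝 α] fun x => (x - α) ^ (n + 1)) (φ : ℝ → 𝓢(ℝ, ℂ))
    (hφ : ∀ ε (hε : 0 < ε), φ ε = localize α u ε hε) :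
    Tendsto (fun ε => τ (φ ε)) (𝓝[>] 0) (𝓝 0) := by
  obtain ⟨C, hC0, hC⟩ := exists_norm_iteratedDeriv_le (u.smooth ⊤)
    (iteratedDeriv_eq_zero_of_isBigO (u.smooth ⊤) hu)
  obtain ⟨B, hB0, hB⟩ := exists_bound_iteratedDeriv cutoff_complex_contDiff
    (hasCompactSupport_of_eq_zero (a := 0) (R := 2) fun y hy => by
      rw [cutoff_eq_zero (by simpa using hy), Complex.ofReal_zero]) n
  have key := H.lessSingular.tendsto (R := 2) (M := 2 ^ n * (C * 2 ^ (n + 1) * B))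
    (fun ε => ((ε ^ (n + 1))⁻¹ : ℂ) • φ ε)
    (fun ε y => ((ε ^ (n + 1))⁻¹ : ℂ) * (u (α + ε * y) * (cutoff y : ℂ))) ?_
  · have hlim : Tendsto (fun ε : ℝ => ((ε ^ ((n : ℝ) + 1 - k) : ℝ) : ℂ)) (𝓝[>] 0) (𝓝 0) := by
      have h1 : Tendsto (fun ε : ℝ => ε ^ ((n : ℝ) + 1 - k)) (𝓝[>] 0) (𝓝 0) := by
        have h2 := (Real.continuousAt_rpow_const 0 ((n : ℝ) + 1 - k)
          (Or.inr (by linarith [H.order_lt]))).tendsto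
        rw [Real.zero_rpow (by linarith [H.order_lt])] at h2
        exact h2.mono_left nhdsWithin_le_nhds
      have h3 := (Complex.continuous_ofReal.tendsto 0).comp h1
      rwa [Complex.ofReal_zero] at h3
    have h3 := hlim.mul key
    rw [mul_zero] at h3
    refine h3.congr' ?_
    filter_upwards [self_mem_nhdsWithin] with ε hε
    have hε' : (0 : ℝ) < ε := hε
    rw [map_smul, smul_eq_mul, ← mul_assoc, ← mul_assoc, ← Complex.ofReal_mul,
      ← Real.rpow_add hε', sub_add_cancel, show ((n : ℝ) + 1) = ((n + 1 : ℕ) : ℝ) by push_cast; rfl,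
      Real.rpow_natCast, Complex.ofReal_pow, mul_inv_cancel₀, one_mul]
    exact pow_ne_zero _ (by exact_mod_cast hε'.ne')
  -- With `ε < 1/2` and `|y| ≤ 2` the point `α + ε y` stays in the unit ball around `α`, where the
  -- Taylor bounds hold.
  · filter_upwards [Ioo_mem_nhdsGT (show (0 : ℝ) < 1 / 2 by norm_num)] with ε hε
    have hε0 : 0 < ε := hε.1
    have hf : ContDiff ℝ ∞ fun y => u (α + ε * y) :=
      (u.smooth ⊤).comp (contDiff_const.add (contDiff_const.mul contDiff_id))
    have hfg := hf.mul cutoff_complex_contDiff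
    have hts : tsupport (fun y => u (α + ε * y) * (cutoff y : ℂ)) ⊆ Icc (-2) 2 :=
      tsupport_subset_of_eq_zero fun y hy => by
        rw [cutoff_eq_zero hy, Complex.ofReal_zero, mul_zero]
    refine ⟨contDiff_const.mul hfg, ?_, ?_, ?_⟩
    · exact (tsupport_mul_subset_right).trans hts
    · intro p hp y
      rw [iteratedDeriv_const_mul_field, norm_mul]
      by_cases hy : y ∈ Icc (-2 : ℝ) 2
      · have hy2 : |y| ≤ 2 := abs_le.2 hy
        have hA : ∀ q ≤ n, ‖iteratedDeriv q (fun y => u (α + ε * y)) y‖ ≤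
            ε ^ (n + 1) * (C * 2 ^ (n + 1)) := by
          intro q hq
          rw [iteratedDeriv_comp_affine (u.smooth ⊤), norm_mul, norm_pow, Complex.norm_real,
            Real.norm_of_nonneg hε0.le]
          have h1 := hC q (by omega) (α + ε * y) (by
            rw [add_sub_cancel_left, abs_mul, abs_of_pos hε0]
            nlinarith [hε.2, abs_nonneg y])
          rw [add_sub_cancel_left, abs_mul, abs_of_pos hε0, mul_pow] at h1
          calc ε ^ q * ‖iteratedDeriv q u (α + ε * y)‖
              ≤ ε ^ q * (C * (ε ^ (n + 1 - q) * |y| ^ (n + 1 - q))) := by gcongr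
            _ = (ε ^ q * ε ^ (n + 1 - q)) * (C * |y| ^ (n + 1 - q)) := by ring
            _ = ε ^ (n + 1) * (C * |y| ^ (n + 1 - q)) := by
                rw [← pow_add, show q + (n + 1 - q) = n + 1 by omega]
            _ ≤ ε ^ (n + 1) * (C * 2 ^ (n + 1)) := by
                gcongr
                calc |y| ^ (n + 1 - q) ≤ 2 ^ (n + 1 - q) := by gcongr
                  _ ≤ 2 ^ (n + 1) := by
                    apply pow_le_pow_right₀ one_le_two; omega
        have h2 := norm_iteratedDeriv_mul_le_of_le hf cutoff_complex_contDiff hA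
          (fun q hq => hB q hq y) p hp
        rw [norm_inv, norm_pow, Complex.norm_real, Real.norm_of_nonneg hε0.le,
          inv_mul_le_iff₀ (by positivity)]
        refine h2.trans (le_of_eq ?_)
        ring
      · rw [iteratedDeriv_eq_zero_of_notMem_tsupport p (fun h => hy (hts h)), norm_zero, mul_zero]
        positivity
    · intro x
      rw [hφ ε hε0]
      simp only [smul_apply, localize_apply, smul_eq_mul]
      rw [mul_div_cancel₀ _ hε0.ne', add_sub_cancel]

theorem eventually_localize_eq_zero {u : 𝓢(ℝ, ℂ)} {φ : ℝ → 𝓢(ℝ, ℂ)}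
    (hφ : ∀ ε (hε : 0 < ε), φ ε = localize α u ε hε) {x : ℝ} (hx : x ≠ α) :
    ∀ᶠ ε in 𝓝[>] (0 : ℝ), φ ε x = 0 := by
  have hpos : 0 < |x - α| / 2 := half_pos (abs_pos.2 (sub_ne_zero.2 hx))
  filter_upwards [Ioo_mem_nhdsGT hpos] with ε hε
  rw [hφ ε hε.1]
  exact localize_eq_zero α u hε.1 (by linarith [hε.2])

/-- Dominated convergence: the zero of order `n + 1` leaves the majorant `(x - α)^(n-k)`, integrable
near `α` because `n - k > -1`, and the localized functions tend to zero pointwise off `α`. -/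
theorem PointSingularity.tendsto_sigmaZero_localize (H : PointSingularity n k r α σ τ s)
    (u : 𝓢(ℝ, ℂ)) (hu : u =O[𝓝 α] fun x => (x - α) ^ (n + 1)) (φ : ℝ → 𝓢(ℝ, ℂ))
    (hφ : ∀ ε (hε : 0 < ε), φ ε = localize α u ε hε) :
    Tendsto (fun ε => sigmaZero n k r α (φ ε)) (𝓝[>] 0) (𝓝 0) := by
  obtain ⟨K, hK0, hK⟩ := exists_norm_le_weight u hu
  have hle : ∀ ε > 0, ∀ x, ‖φ ε x‖ ≤ ‖u x‖ := fun ε hε x => by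
    rw [hφ ε hε]; exact norm_localize_le α u ε hε x
  have h1 : Tendsto (fun ε => ∫ x in Ioi α, (((x - α) ^ (-k - 1) : ℝ) : ℂ) *
      ((Real.exp (-(r * (x - α))) : ℂ) * φ ε x)) (𝓝[>] 0) (𝓝 (∫ x in Ioi α, (0 : ℂ))) := by
    refine tendsto_integral_filter_of_dominated_convergence
      ((Ioc α (α + 1)).indicator fun x => K * (x - α) ^ ((n : ℝ) - k)) ?_ ?_ ?_ ?_
    · refine Eventually.of_forall fun ε => ?_
      refine ContinuousOn.aestronglyMeasurable ?_ measurableSet_Ioi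
      refine ContinuousOn.mul ?_ (Continuous.continuousOn ?_)
      · refine Complex.continuous_ofReal.comp_continuousOn ?_
        refine ContinuousOn.rpow_const (by fun_prop) fun x hx => Or.inl ?_
        exact (sub_pos.2 hx).ne'
      · exact (by fun_prop : Continuous fun x : ℝ => (Real.exp (-(r * (x - α))) : ℂ)).mul
          (φ ε).continuous
    · filter_upwards [Ioo_mem_nhdsGT (show (0 : ℝ) < 1 / 2 by norm_num)] with ε hε
      refine (ae_restrict_iff' measurableSet_Ioi).2 (ae_of_all _ fun x hx => ?_)
      have hx0 : 0 < x - α := sub_pos.2 hx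
      by_cases hx1 : x ∈ Ioc α (α + 1)
      · rw [indicator_of_mem hx1, norm_mul, norm_mul, Complex.norm_real, Complex.norm_real,
          Real.norm_of_nonneg (Real.rpow_nonneg hx0.le _), Real.norm_of_nonneg (Real.exp_pos _).le]
        have h2 : Real.exp (-(r * (x - α))) ≤ 1 := by
          rw [Real.exp_le_one_iff]
          linarith [mul_nonneg H.nonneg_rate hx0.le]
        have h3 : ‖φ ε x‖ ≤ K * (x - α) ^ (n + 1) := by
          refine (hle ε hε.1 x).trans ((hK x).trans ?_)
          have := weight_le_pow n α x
          rw [abs_of_pos hx0] at this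
          gcongr
        calc (x - α) ^ (-k - 1) * (Real.exp (-(r * (x - α))) * ‖φ ε x‖)
            ≤ (x - α) ^ (-k - 1) * (1 * (K * (x - α) ^ (n + 1))) := by gcongr
          _ = K * ((x - α) ^ (-k - 1) * (x - α) ^ (((n + 1 : ℕ) : ℝ))) := by
              rw [Real.rpow_natCast]; ring
          _ = K * (x - α) ^ ((n : ℝ) - k) := by
              rw [← Real.rpow_add hx0]; push_cast; ring_nf
      · rw [indicator_of_notMem hx1, hφ ε hε.1, localize_apply, localize_eq_zero α u hε.1]
        · simp
        · have : α + 1 < x := by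
            by_contra h; exact hx1 ⟨hx, not_lt.1 h⟩
          rw [abs_of_pos hx0]
          linarith [hε.2]
    · rw [integrable_indicator_iff measurableSet_Ioc]
      refine Integrable.const_mul ?_ K
      have h4 : IntervalIntegrable (fun x : ℝ => x ^ ((n : ℝ) - k)) volume 0 1 :=
        intervalIntegral.intervalIntegrable_rpow' (by linarith [H.order_lt])
      have h5 := h4.comp_sub_right α
      rw [zero_add, add_comm, intervalIntegrable_iff_integrableOn_Ioc_of_le (by linarith)] at h5
      exact IntegrableOn.mono_measure h5 Measure.restrict_le_self
    · refine (ae_restrict_iff' measurableSet_Ioi).2 (ae_of_all _ fun x hx => ?_)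
      refine tendsto_const_nhds.congr' ?_
      filter_upwards [eventually_localize_eq_zero hφ (ne_of_gt hx)] with ε hε
      simp [hε]
  have h6 := h1.const_mul (1 / Real.Gamma (-k) : ℂ)
  rw [integral_zero, mul_zero] at h6
  refine h6.congr' ?_
  filter_upwards [self_mem_nhdsWithin] with ε hε
  rw [sigmaZero_eq_integral]
  refine Asymptotics.IsBigO.trans (Asymptotics.IsBigO.of_bound 1 ?_) hu
  exact Eventually.of_forall fun x => by rw [one_mul]; exact hle ε hε x

/-- On functions vanishing to order `n + 1` at `α`, the distribution `σ` is given by integration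
against the function `s`. -/
theorem PointSingularity.eq_integral (H : PointSingularity n k r α σ τ s)
    (u : 𝓢(ℝ, ℂ)) (hu : u =O[𝓝 α] fun x => (x - α) ^ (n + 1)) :
    σ u = ∫ x in Ioi (0 : ℝ), (s x : ℂ) * u x := by
  obtain ⟨K, hK0, hK⟩ := exists_norm_le_weight u hu
  let φ : ℝ → 𝓢(ℝ, ℂ) := fun ε => if hε : 0 < ε then localize α u ε hε else 0
  have hφ : ∀ ε (hε : 0 < ε), φ ε = localize α u ε hε := fun ε hε => dif_pos hε
  have hle : ∀ ε > 0, ∀ x, ‖φ ε x‖ ≤ ‖u x‖ := fun ε hε x => by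
    rw [hφ ε hε]; exact norm_localize_le α u ε hε x
  have h1 : Tendsto (fun ε => σ (φ ε)) (𝓝[>] 0) (𝓝 0) := by
    have := (H.tendsto_sigmaZero_localize u hu φ hφ).add
      (H.tendsto_lessSingular_localize u hu φ hφ)
    rw [add_zero] at this
    exact this.congr fun ε => (H.decomp _).symm
  have hui := (H.integrableOn_mul u.continuous fun x _ => hK x).1
  have hφi : ∀ ε > 0, IntegrableOn (fun x => (s x : ℂ) * φ ε x) (Ioi 0) := fun ε hε =>
    (H.integrableOn_mul (φ ε).continuous fun x _ => (hle ε hε x).trans (hK x)).1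
  have h2 : Tendsto (fun ε => ∫ x in Ioi (0 : ℝ), (s x : ℂ) * φ ε x) (𝓝[>] 0)
      (𝓝 (∫ x in Ioi (0 : ℝ), (0 : ℂ))) := by
    refine tendsto_integral_filter_of_dominated_convergence (fun x => ‖(s x : ℂ) * u x‖) ?_ ?_
      hui.norm ?_
    · filter_upwards [self_mem_nhdsWithin] with ε hε using (hφi ε hε).aestronglyMeasurable
    · filter_upwards [self_mem_nhdsWithin] with ε hε
      refine ae_of_all _ fun x => ?_
      rw [norm_mul, norm_mul]
      gcongr
      exact hle ε hε x
    · have : ∀ᵐ x ∂volume.restrict (Ioi (0 : ℝ)), x ≠ α :=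
        ae_restrict_of_ae (Measure.ae_ne volume α)
      filter_upwards [this] with x hx
      refine tendsto_const_nhds.congr' ?_
      filter_upwards [eventually_localize_eq_zero hφ hx] with ε hε
      simp [hε]
  rw [integral_zero] at h2
  -- The difference `u - φ ε` vanishes near `α`, where alone `σ` could differ from `s`. Hence the
  -- defect `σ - ∫ s` takes the same value on `u` and on every `φ ε`, and the latter values tend to
  -- zero.
  have h3 : ∀ᶠ ε in 𝓝[>] (0 : ℝ), σ u - ∫ x in Ioi (0 : ℝ), (s x : ℂ) * u x =
      σ (φ ε) - ∫ x in Ioi (0 : ℝ), (s x : ℂ) * φ ε x := by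
    filter_upwards [self_mem_nhdsWithin] with ε hε
    have h4 := H.eq_function (u - φ ε) (by
      rw [hφ ε hε]; exact notMem_tsupport_sub_localize α u ε hε)
    rw [map_sub] at h4
    have h5 : ∫ x in Ioi (0 : ℝ), (s x : ℂ) * (u - φ ε) x =
        (∫ x in Ioi (0 : ℝ), (s x : ℂ) * u x) - ∫ x in Ioi (0 : ℝ), (s x : ℂ) * φ ε x := by
      rw [← integral_sub hui (hφi ε hε)]
      simp only [sub_apply, mul_sub]
    rw [h5] at h4
    linear_combination h4
  have h6 := h1.sub h2
  rw [sub_zero] at h6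
  have h7 := tendsto_nhds_unique (tendsto_const_nhds.congr' h3) h6
  exact sub_eq_zero.1 h7

end Structure

/-! ### Laplace transforms of test functions -/

section Laplace

theorem Test.exists_support_bound (F : Test) :
    ∃ c > 0, ∃ d, ∀ t, F t ≠ 0 → c ≤ t ∧ t ≤ d := by
  have hK : IsCompact (tsupport F) := F.hasCompactSupport
  rcases (tsupport F).eq_empty_or_nonempty with h | h
  · refine ⟨1, one_pos, 0, fun t ht => ?_⟩
    have := subset_tsupport F ht
    rw [h] at this
    exact this.elim
  · obtain ⟨a, ha, hamin⟩ := hK.exists_isMinOn h continuousOn_id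
    obtain ⟨b, hb, hbmax⟩ := hK.exists_isMaxOn h continuousOn_id
    exact ⟨a, F.tsupport_subset ha, b, fun t ht =>
      ⟨hamin (subset_tsupport F ht), hbmax (subset_tsupport F ht)⟩⟩

theorem Test.integrable_smul (F : Test) {g : ℝ → ℂ} (hg : Continuous g) :
    Integrable fun t => g t * F t :=
  (hg.mul F.continuous).integrable_of_hasCompactSupport F.hasCompactSupport.mul_left

theorem laplace_eq_integral (F : Test) (x : ℝ) :
    laplace F x = ∫ t, (Real.exp (-(t * x)) : ℂ) * F t := by
  unfold laplace
  refine setIntegral_eq_integral_of_forall_compl_eq_zero fun t ht => ?_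
  rw [test_eq_zero F (not_lt.1 ht), mul_zero]

theorem Test.integrable_exp_mul (F : Test) (x : ℝ) :
    Integrable fun t => (Real.exp (-(t * x)) : ℂ) * F t :=
  F.integrable_smul (by fun_prop)

theorem laplace_add (F G : Test) (x : ℝ) : laplace (F + G) x = laplace F x + laplace G x := by
  rw [laplace_eq_integral, laplace_eq_integral, laplace_eq_integral,
    ← integral_add (F.integrable_exp_mul x) (G.integrable_exp_mul x)]
  refine integral_congr_ae (ae_of_all _ fun t => ?_)
  simp only [add_apply, mul_add]

theorem laplace_smul (c : ℂ) (F : Test) (x : ℝ) : laplace (c • F) x = c * laplace F x := by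
  rw [laplace_eq_integral, laplace_eq_integral, ← integral_const_mul]
  refine integral_congr_ae (ae_of_all _ fun t => ?_)
  simp only [smul_apply, smul_eq_mul]
  ring

theorem laplace_conjTest (F : Test) (x : ℝ) :
    laplace (conjTest F) x = starRingEnd ℂ (laplace F x) := by
  rw [laplace_eq_integral, laplace_eq_integral, ← integral_conj]
  refine integral_congr_ae (ae_of_all _ fun t => ?_)
  simp only [map_mul, Complex.conj_ofReal]
  rfl

theorem laplace_laplaceConv (F G : Test) (x : ℝ) :
    laplace (laplaceConv F G) x = laplace F x * laplace G x := by
  rw [laplace_eq_integral, laplace_eq_integral, laplace_eq_integral]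
  have h := integral_convolution (ContinuousLinearMap.mul ℝ ℂ) (F.integrable_exp_mul x)
    (G.integrable_exp_mul x)
  rw [ContinuousLinearMap.mul_apply'] at h
  rw [← h]
  refine integral_congr_ae (ae_of_all _ fun t => ?_)
  have h1 : laplaceConv F G t =
      convolution F G (ContinuousLinearMap.mul ℝ ℂ) volume t := congrFun (laplaceConv_eq F G) t
  simp only
  rw [h1, convolution_def, convolution_def, ← integral_const_mul]
  refine integral_congr_ae (ae_of_all _ fun s => ?_)
  simp only [ContinuousLinearMap.mul_apply']
  have h2 : Real.exp (-(t * x)) = Real.exp (-(s * x)) * Real.exp (-((t - s) * x)) := by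
    rw [← Real.exp_add]; ring_nf
  rw [h2, Complex.ofReal_mul]
  ring

/-- The test function `t ↦ -t F(t)`. -/
noncomputable def negIdMul (F : Test) : Test where
  toFun t := (-t : ℂ) * F t
  contDiff' := (Complex.ofRealCLM.contDiff.neg).mul F.contDiff
  hasCompactSupport' := F.hasCompactSupport.mul_left
  tsupport_subset' := tsupport_mul_subset_right.trans F.tsupport_subset

theorem negIdMul_apply (F : Test) (t : ℝ) : negIdMul F t = (-t : ℂ) * F t := rfl

theorem hasDerivAt_laplace (F : Test) (x : ℝ) :
    HasDerivAt (laplace F) (laplace (negIdMul F) x) x := by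
  obtain ⟨c, hc, d, hcd⟩ := F.exists_support_bound
  have h := hasDerivAt_integral_of_dominated_loc_of_deriv_le (𝕜 := ℝ) (μ := volume)
    (F := fun x t => (Real.exp (-(t * x)) : ℂ) * F t)
    (F' := fun x t => (Real.exp (-(t * x)) : ℂ) * negIdMul F t) (x₀ := x)
    (bound := fun t => ‖(Real.exp (|d| * (|x| + 1)) : ℂ) * negIdMul F t‖)
    (Metric.ball_mem_nhds x one_pos)
    (Eventually.of_forall fun y => (F.integrable_exp_mul y).aestronglyMeasurable)
    (F.integrable_exp_mul x) ((negIdMul F).integrable_exp_mul x).aestronglyMeasurable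
    (ae_of_all _ fun t y hy => by
      rw [norm_mul, norm_mul]
      by_cases hF : F t = 0
      · simp [negIdMul_apply, hF]
      · refine mul_le_mul_of_nonneg_right ?_ (norm_nonneg _)
        rw [Complex.norm_real, Complex.norm_real, Real.norm_of_nonneg (Real.exp_pos _).le,
          Real.norm_of_nonneg (Real.exp_pos _).le]
        refine Real.exp_le_exp.2 ((neg_le_abs _).trans ?_)
        rw [abs_mul]
        have h1 := hcd t hF
        have h2 : |t| ≤ |d| := by
          rw [abs_of_pos (hc.trans_le h1.1), abs_of_pos (hc.trans_le (h1.1.trans h1.2))]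
          exact h1.2
        have h3 : |y| ≤ |x| + 1 := by
          have h4 : |y - x| < 1 := by simpa [Real.dist_eq] using hy
          have := abs_sub_abs_le_abs_sub y x
          linarith
        gcongr)
    ((negIdMul F).integrable_smul continuous_const).norm
    (ae_of_all _ fun t y _ => by
      have h1 : HasDerivAt (fun y : ℝ => -(t * y)) (-t) y := by
        have h0 := (hasDerivAt_id y).const_mul (-t)
        simp only [mul_one, neg_mul] at h0
        exact h0
      have h2 := (h1.exp.ofReal_comp).mul_const (F t)
      have h3 : ((Real.exp (-(t * y)) * -t : ℝ) : ℂ) * F t =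
          (Real.exp (-(t * y)) : ℂ) * negIdMul F t := by
        rw [negIdMul_apply]
        push_cast
        ring
      exact h3 ▸ h2)
  have e : laplace F = fun x => ∫ t, (Real.exp (-(t * x)) : ℂ) * F t :=
    funext (laplace_eq_integral F)
  rw [e, laplace_eq_integral]
  exact h.2

theorem iteratedDeriv_laplace (F : Test) (p : ℕ) :
    iteratedDeriv p (laplace F) = laplace (negIdMul^[p] F) := by
  induction p with
  | zero => simp
  | succ p ih =>
    rw [iteratedDeriv_succ, ih, Function.iterate_succ_apply']
    exact funext fun x => (hasDerivAt_laplace _ x).deriv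

theorem laplace_contDiff (F : Test) : ContDiff ℝ ∞ (laplace F) := by
  refine contDiff_of_differentiable_iteratedDeriv fun m _ => ?_
  rw [iteratedDeriv_laplace]
  exact fun x => (hasDerivAt_laplace _ x).differentiableAt

/-- If `c ≤ t ≤ d` on the support and `x ≥ -2`, then `-tx = 2t - t(x + 2) ≤ 2d - c(x + 2)`, and `c >
0` gives exponential decay. The range begins at `-2` because `laplaceSchwartz` vanishes to the left
of it. -/
theorem exists_laplace_decay (F : Test) (N : ℕ) :
    ∃ C, ∀ x, -2 ≤ x → |x| ^ N * ‖laplace F x‖ ≤ C := by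
  obtain ⟨c, hc, d, hcd⟩ := F.exists_support_bound
  have hI : Integrable fun t => ‖F t‖ := by
    simpa using (F.integrable_smul continuous_one).norm
  have h1 : ∀ x, -2 ≤ x → ‖laplace F x‖ ≤
      Real.exp (2 * d) * Real.exp (-(c * (x + 2))) * ∫ t, ‖F t‖ := by
    intro x hx
    rw [laplace_eq_integral, ← integral_const_mul]
    refine norm_integral_le_of_norm_le (hI.const_mul _) (ae_of_all _ fun t => ?_)
    rw [norm_mul, Complex.norm_real, Real.norm_of_nonneg (Real.exp_pos _).le]
    by_cases hF : F t = 0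
    · simp [hF]
    · refine mul_le_mul_of_nonneg_right ?_ (norm_nonneg _)
      rw [← Real.exp_add]
      refine Real.exp_le_exp.2 ?_
      obtain ⟨h2, h3⟩ := hcd t hF
      nlinarith
  have h2 : ∃ C, ∀ x, -2 ≤ x → |x| ^ N * Real.exp (-(c * (x + 2))) ≤ C := by
    have hc1 : Continuous fun x : ℝ => |x| ^ N * Real.exp (-(c * (x + 2))) := by fun_prop
    have ht : Tendsto (fun x : ℝ => |x| ^ N * Real.exp (-(c * (x + 2)))) atTop (𝓝 0) := by
      have h3 := tendsto_rpow_mul_exp_neg_mul_atTop_nhds_zero N c hc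
      have h4 := h3.mul_const (Real.exp (-(c * 2)))
      rw [zero_mul] at h4
      refine h4.congr' ?_
      filter_upwards [eventually_ge_atTop 0] with x hx
      rw [abs_of_nonneg hx, mul_assoc, ← Real.exp_add, Real.rpow_natCast]
      ring_nf
    obtain ⟨b, hb⟩ := eventually_atTop.1 (ht.eventually (gt_mem_nhds one_pos))
    obtain ⟨C, hC⟩ := (isCompact_Icc (a := (-2 : ℝ)) (b := b)).exists_bound_of_continuousOn
      hc1.continuousOn
    refine ⟨max C 1, fun x hx => ?_⟩
    rcases le_total x b with hxb | hxb
    · exact ((le_abs_self _).trans (hC x ⟨hx, hxb⟩)).trans (le_max_left _ _)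
    · exact (hb x hxb).le.trans (le_max_right _ _)
  obtain ⟨C, hC⟩ := h2
  refine ⟨C * (Real.exp (2 * d) * ∫ t, ‖F t‖), fun x hx => ?_⟩
  have hI0 : 0 ≤ ∫ t, ‖F t‖ := integral_nonneg fun t => norm_nonneg _
  calc |x| ^ N * ‖laplace F x‖
      ≤ |x| ^ N * (Real.exp (2 * d) * Real.exp (-(c * (x + 2))) * ∫ t, ‖F t‖) := by
        gcongr
        exact h1 x hx
    _ = (|x| ^ N * Real.exp (-(c * (x + 2)))) * (Real.exp (2 * d) * ∫ t, ‖F t‖) := by ring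
    _ ≤ _ := by
        gcongr
        exact hC x hx

theorem contDiff_smoothTransition_mul_laplace (F : Test) :
    ContDiff ℝ ∞ fun x => (Real.smoothTransition (x + 2) : ℂ) * laplace F x := by
  have h1 : ContDiff ℝ ∞ fun x : ℝ => Real.smoothTransition (x + 2) :=
    Real.smoothTransition.contDiff.comp (contDiff_id.add contDiff_const)
  exact (Complex.ofRealCLM.contDiff.comp h1).mul (laplace_contDiff F)

/-- A Schwartz function that coincides with the Laplace transform of `F` on `[-1, ∞)`. -/
noncomputable def laplaceSchwartz (F : Test) : 𝓢(ℝ, ℂ) where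
  toFun x := (Real.smoothTransition (x + 2) : ℂ) * laplace F x
  smooth' := contDiff_smoothTransition_mul_laplace F
  decay' N p := by
    have hs := contDiff_smoothTransition_mul_laplace F
    have hcont : Continuous fun x : ℝ => |x| ^ N *
        ‖iteratedDeriv p (fun x => (Real.smoothTransition (x + 2) : ℂ) * laplace F x) x‖ :=
      (continuous_abs.pow N).mul (hs.continuous_iteratedDeriv p (by exact_mod_cast le_top)).norm
    obtain ⟨C₁, hC₁⟩ := (isCompact_Icc (a := (-2 : ℝ)) (b := 0)).exists_bound_of_continuousOn
      hcont.continuousOn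
    obtain ⟨C₂, hC₂⟩ := exists_laplace_decay (negIdMul^[p] F) N
    refine ⟨max C₁ C₂, fun x => ?_⟩
    rw [norm_iteratedFDeriv_eq_norm_iteratedDeriv, Real.norm_eq_abs]
    rcases lt_or_ge x (-2) with hx | hx
    · have h0 : (fun x => (Real.smoothTransition (x + 2) : ℂ) * laplace F x) =ᶠ[𝓝 x]
          fun _ => 0 := by
        filter_upwards [Iio_mem_nhds hx] with y hy
        rw [Real.smoothTransition.zero_of_nonpos (by linarith [mem_Iio.1 hy]),
          Complex.ofReal_zero, zero_mul]
      rw [h0.iteratedDeriv_eq p]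
      have : iteratedDeriv p (fun _ : ℝ => (0 : ℂ)) x = 0 := by
        rw [iteratedDeriv_const]; simp
      rw [this, norm_zero, mul_zero]
      exact (norm_nonneg _).trans (hC₁ 0 (by norm_num)) |>.trans (le_max_left _ _)
    · rcases le_or_gt x 0 with hx0 | hx0
      · exact ((le_abs_self _).trans (hC₁ x ⟨hx, hx0⟩)).trans (le_max_left _ _)
      · have h0 : (fun x => (Real.smoothTransition (x + 2) : ℂ) * laplace F x) =ᶠ[𝓝 x]
            laplace F := by
          filter_upwards [Ioi_mem_nhds hx0] with y hy
          rw [Real.smoothTransition.one_of_one_le (by linarith [mem_Ioi.1 hy]),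
            Complex.ofReal_one, one_mul]
        rw [h0.iteratedDeriv_eq p, iteratedDeriv_laplace]
        exact (hC₂ x hx).trans (le_max_right _ _)

theorem laplaceSchwartz_apply (F : Test) {x : ℝ} (hx : -1 ≤ x) :
    laplaceSchwartz F x = laplace F x := by
  change (Real.smoothTransition (x + 2) : ℂ) * laplace F x = laplace F x
  rw [Real.smoothTransition.one_of_one_le (by linarith), Complex.ofReal_one, one_mul]

/-- The test function `t ↦ F(t - l)`, for `l ≥ 0`. -/
noncomputable def shiftRight (F : Test) (l : ℕ) : Test where
  toFun t := F (t - l)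
  contDiff' := F.contDiff.comp (contDiff_id.sub contDiff_const)
  hasCompactSupport' := F.hasCompactSupport.comp_homeomorph (Homeomorph.subRight (l : ℝ))
  tsupport_subset' := by
    intro t ht
    have h1 : t - l ∈ tsupport F := by
      have := tsupport_comp_subset_preimage (F : ℝ → ℂ) (f := fun t : ℝ => t - l) (by fun_prop) ht
      exact this
    have h2 : (0 : ℝ) < t - l := F.tsupport_subset h1
    have h3 : (0 : ℝ) ≤ l := Nat.cast_nonneg l
    change (0 : ℝ) < t
    linarith

theorem laplace_shiftRight (F : Test) (l : ℕ) (x : ℝ) :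
    laplace (shiftRight F l) x = (Real.exp (-x) : ℂ) ^ l * laplace F x := by
  rw [laplace_eq_integral, laplace_eq_integral, ← integral_const_mul,
    ← integral_sub_right_eq_self (fun t => _ * (_ * F t)) (l : ℝ)]
  refine integral_congr_ae (ae_of_all _ fun t => ?_)
  have h1 : Real.exp (-(t * x)) = Real.exp (-x) ^ l * Real.exp (-((t - l) * x)) := by
    rw [← Real.exp_nat_mul, ← Real.exp_add]; ring_nf
  have h2 : shiftRight F l t = F (t - l) := rfl
  simp only
  rw [h1, h2, Complex.ofReal_mul, Complex.ofReal_pow]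
  ring

/-- A bump function centred at `2` and supported in `[1, 3]`. -/
noncomputable def bump : ContDiffBump (2 : ℝ) := ⟨1 / 2, 1, by norm_num, by norm_num⟩

/-- The bump function as a test function on the half-line. -/
noncomputable def bumpTest : Test where
  toFun t := (bump t : ℂ)
  contDiff' := Complex.ofRealCLM.contDiff.comp bump.contDiff
  hasCompactSupport' := bump.hasCompactSupport.comp_left (g := ((↑) : ℝ → ℂ)) Complex.ofReal_zero
  tsupport_subset' := by
    have h : tsupport (fun t => (bump t : ℂ)) ⊆ tsupport bump :=
      closure_mono (Function.support_comp_subset (g := ((↑) : ℝ → ℂ)) Complex.ofReal_zero _)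
    refine h.trans ?_
    rw [bump.tsupport_eq]
    intro t ht
    have ht' : |t - 2| ≤ 1 := by simpa [Real.dist_eq, bump] using ht
    change (0 : ℝ) < t
    linarith [(abs_le.1 ht').1]

/-- The Laplace transform of the bump function, a positive function on the line. -/
noncomputable def bumpLaplace (x : ℝ) : ℝ := ∫ t, Real.exp (-(t * x)) * bump t

theorem laplace_bumpTest (x : ℝ) : laplace bumpTest x = (bumpLaplace x : ℂ) := by
  rw [laplace_eq_integral, bumpLaplace, ← integral_complex_ofReal]
  refine integral_congr_ae (ae_of_all _ fun t => ?_)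
  simp only [Complex.ofReal_mul]
  rfl

theorem bumpLaplace_pos (x : ℝ) : 0 < bumpLaplace x := by
  have hc : Continuous fun t => Real.exp (-(t * x)) * bump t :=
    (by fun_prop : Continuous fun t : ℝ => Real.exp (-(t * x))).mul bump.continuous
  refine hc.integral_pos_of_hasCompactSupport_nonneg_nonzero bump.hasCompactSupport.mul_left
    (fun t => mul_nonneg (Real.exp_pos _).le bump.nonneg) (x := 2) ?_
  exact (mul_pos (Real.exp_pos _) (bump.pos_of_mem_ball (Metric.mem_ball_self bump.rOut_pos))).ne'

theorem bumpLaplace_contDiff : ContDiff ℝ ∞ bumpLaplace := by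
  have h1 : ContDiff ℝ ∞ fun x => (laplace bumpTest x).re :=
    Complex.reCLM.contDiff.comp (laplace_contDiff bumpTest)
  simpa [laplace_bumpTest] using h1

/-- Shifting a test function by `l` multiplies its transform by `e^{-lx}`. Transforms of
combinations of shifted bumps are thus polynomials in `e^{-x}` times a fixed positive function,
which opens the way to Weierstrass approximation. -/
theorem exists_laplace_eq_eval (P : Polynomial ℝ) :
    ∃ f : Test, ∀ x, laplace f x = ((P.eval (Real.exp (-x)) * bumpLaplace x : ℝ) : ℂ) := by
  induction P using Polynomial.induction_on' with
  | add P Q hP hQ =>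
    obtain ⟨f, hf⟩ := hP
    obtain ⟨g, hg⟩ := hQ
    refine ⟨f + g, fun x => ?_⟩
    rw [laplace_add, hf, hg, Polynomial.eval_add]
    push_cast
    ring
  | monomial l a =>
    refine ⟨(a : ℂ) • shiftRight bumpTest l, fun x => ?_⟩
    rw [laplace_smul, laplace_shiftRight, laplace_bumpTest, Polynomial.eval_monomial]
    push_cast
    ring

end Laplace

/-! ### Bounds for the index of positivity -/

section PosIndex

variable {V : Type*} [AddCommGroup V] [Module ℂ V] {q : V → ℝ} {m : ℕ}

/-- A subspace on which `q` is positive meets `ker L` only in zero, so `L` embeds it in `ℂ^m`. -/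
theorem posIndex_le (L : V →ₗ[ℂ] (Fin m → ℂ)) (hL : ∀ v, L v = 0 → q v ≤ 0) :
    posIndex q ≤ m := by
  refine iSup₂_le fun M hM => ?_
  have hinj : Function.Injective (L.domRestrict M) := by
    refine (injective_iff_map_eq_zero _).2 fun v hv => ?_
    by_contra hne
    have h1 := hM v v.2 (by simpa using hne)
    exact absurd (hL v hv) (not_le.2 h1)
  have h2 := LinearMap.lift_rank_le_of_injective _ hinj
  simp only [rank_fin_fun, Cardinal.lift_natCast] at h2
  have h3 : Module.rank ℂ M ≤ (m : Cardinal) := by simpa using h2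
  simpa using Cardinal.toENat_le_natCast.2 h3

theorem le_posIndex (e : (Fin m → ℂ) →ₗ[ℂ] V) (h0 : q 0 ≤ 0) (he : ∀ c, c ≠ 0 → 0 < q (e c)) :
    (m : ℕ∞) ≤ posIndex q := by
  have hinj : Function.Injective e := by
    refine (injective_iff_map_eq_zero _).2 fun c hc => ?_
    by_contra hne
    have h1 := he c hne
    rw [hc] at h1
    exact absurd h0 (not_le.2 h1)
  have hM : ∀ v ∈ LinearMap.range e, v ≠ 0 → 0 < q v := by
    rintro _ ⟨c, rfl⟩ hne
    exact he c fun hc => hne (by rw [hc, map_zero])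
  refine le_trans ?_ (le_iSup₂ (f := fun (M : Submodule ℂ V)
    (_ : ∀ v ∈ M, v ≠ 0 → 0 < q v) => Cardinal.toENat (Module.rank ℂ M)) (LinearMap.range e) hM)
  have h2 : Cardinal.lift.{0} (Module.rank ℂ (LinearMap.range e)) =
      Cardinal.lift (Module.rank ℂ (Fin m → ℂ)) := LinearEquiv.lift_rank_eq
        (LinearEquiv.ofInjective e hinj).symm
  simp only [rank_fin_fun, Cardinal.lift_natCast] at h2
  have h3 : Module.rank ℂ (LinearMap.range e) = (m : Cardinal) := by simpa using h2
  rw [h3]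
  simp

end PosIndex

/-! ### The upper bound -/

/-- The jet of order `m - 1` at `α` of the Laplace transform. -/
noncomputable def laplaceJet (m : ℕ) (α : ℝ) : Test →ₗ[ℂ] (Fin m → ℂ) where
  toFun f j := iteratedDeriv j (laplace f) α
  map_add' f g := by
    ext j
    have h : laplace (f + g) = laplace f + laplace g := funext fun x => laplace_add f g x
    simp only [Pi.add_apply]
    rw [h, iteratedDeriv_add]
    · exact ((laplace_contDiff f).of_le (by exact_mod_cast le_top)).contDiffAt
    · exact ((laplace_contDiff g).of_le (by exact_mod_cast le_top)).contDiffAt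
  map_smul' c f := by
    ext j
    have h : laplace (c • f) = fun x => c * laplace f x := funext fun x => laplace_smul c f x
    rw [h, iteratedDeriv_const_mul_field]
    rfl

section UpperBound

variable {n : ℕ} {k r α : ℝ} {σ τ : 𝓢'(ℝ, ℂ)} {s : ℝ → ℝ} {h : Dist}

theorem IsSigmaFunction.apply_laplaceConv (hσ : IsSigmaFunction h σ) (f g : Test) :
    h (laplaceConv f g) = σ (laplaceSchwartz (laplaceConv f g)) :=
  hσ _ _ ⟨1, one_pos, fun _ hx => laplaceSchwartz_apply _ hx.le⟩

theorem laplaceSchwartz_laplaceConv_conjTest (f : Test) {x : ℝ} (hx : -1 ≤ x) :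
    laplaceSchwartz (laplaceConv (conjTest f) f) x = ((‖laplace f x‖ ^ 2 : ℝ) : ℂ) := by
  rw [laplaceSchwartz_apply _ hx, laplace_laplaceConv, laplace_conjTest, mul_comm,
    Complex.mul_conj, Complex.normSq_eq_norm_sq]

/-- Here `|Lf|²` is `O((x - α)^(2m))` with `2m ≥ n + 1`, so the form is the honest integral `∫ s
|Lf|²` and inherits the sign of `s`. -/
theorem PointSingularity.hankelForm_nonpos (H : PointSingularity n k r α σ τ s)
    (hσ : IsSigmaFunction h σ) (hsign : ∀ x, 0 < x → x ≠ α → 0 ≤ (-1) ^ (n + 1) * s x)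
    {m : ℕ} (hm : n + 1 ≤ 2 * m) (f : Test) (hf : laplaceJet m α f = 0) :
    (-1) ^ n * hankelForm h f ≤ 0 := by
  have hO : laplace f =O[𝓝 α] fun x => (x - α) ^ m :=
    isBigO_of_iteratedDeriv_eq_zero (laplace_contDiff f) fun p hp => congrFun hf ⟨p, hp⟩
  have hu : laplaceSchwartz (laplaceConv (conjTest f) f) =O[𝓝 α]
      fun x => (x - α) ^ (n + 1) := by
    have h1 : (fun x => ((‖laplace f x‖ ^ 2 : ℝ) : ℂ)) =O[𝓝 α] fun x => (x - α) ^ (2 * m) := by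
      refine Asymptotics.IsBigO.of_norm_left ?_
      have h2 := (hO.norm_left.mul hO.norm_left)
      refine (h2.congr_left fun x => ?_).congr_right fun x => ?_
      · rw [Complex.norm_real, Real.norm_of_nonneg (by positivity), sq]
      · rw [two_mul, pow_add]
    have h3 : (fun x : ℝ => (x - α) ^ (2 * m)) =O[𝓝 α] fun x => (x - α) ^ (n + 1) := by
      refine Asymptotics.IsBigO.of_bound 1 ?_
      filter_upwards [Metric.closedBall_mem_nhds α one_pos] with x hx
      have hx' : |x - α| ≤ 1 := by simpa [Real.dist_eq] using hx
      rw [one_mul, norm_pow, norm_pow, Real.norm_eq_abs]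
      exact pow_le_pow_of_le_one (abs_nonneg _) hx' hm
    refine (h1.trans h3).congr' ?_ EventuallyEq.rfl
    filter_upwards [Ioi_mem_nhds H.pos_point] with x hx
    exact (laplaceSchwartz_laplaceConv_conjTest f (by linarith [mem_Ioi.1 hx])).symm
  have h4 : hankelForm h f = ∫ x in Ioi (0 : ℝ), s x * ‖laplace f x‖ ^ 2 := by
    unfold hankelForm
    rw [hσ.apply_laplaceConv, H.eq_integral _ hu]
    have h5 : ∫ x in Ioi (0 : ℝ), (s x : ℂ) * laplaceSchwartz (laplaceConv (conjTest f) f) x =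
        ∫ x in Ioi (0 : ℝ), ((s x * ‖laplace f x‖ ^ 2 : ℝ) : ℂ) := by
      refine setIntegral_congr_fun measurableSet_Ioi fun x hx => ?_
      rw [laplaceSchwartz_laplaceConv_conjTest f (by linarith [mem_Ioi.1 hx]), Complex.ofReal_mul]
    rw [h5, integral_complex_ofReal, Complex.ofReal_re]
  rw [h4, ← integral_const_mul]
  refine integral_nonpos_of_ae ?_
  have hne : ∀ᵐ x ∂volume.restrict (Ioi (0 : ℝ)), x ≠ α :=
    ae_restrict_of_ae (Measure.ae_ne volume α)
  filter_upwards [hne, ae_restrict_mem measurableSet_Ioi] with x hx hx0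
  have h6 := hsign x hx0 hx
  rw [pow_succ] at h6
  have h7 : 0 ≤ ‖laplace f x‖ ^ 2 := by positivity
  simp only [Pi.zero_apply]
  nlinarith [mul_nonneg h6 h7]

end UpperBound

/-! ### The sign of `Γ(-k)` and the regularized moments -/

/-- The recursion `Γ(1 - k) = -k Γ(-k)` flips the sign each time `k` grows by one, starting from `Γ
> 0` on `(0, 1)`. -/
theorem neg_one_pow_mul_Gamma_neg_pos (n : ℕ) :
    ∀ k : ℝ, (n : ℝ) < k → k < n + 1 → 0 < (-1) ^ (n + 1) * Real.Gamma (-k) := by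
  induction n with
  | zero =>
    intro k h1 h2
    norm_num at h1 h2
    have h3 := Real.Gamma_add_one (s := -k) (by linarith)
    have h4 : 0 < Real.Gamma (-k + 1) := Real.Gamma_pos_of_pos (by linarith)
    rw [h3] at h4
    norm_num
    by_contra h5
    nlinarith [not_lt.1 h5]
  | succ n ih =>
    intro k h1 h2
    push_cast at h1 h2
    have h3 := Real.Gamma_add_one (s := -k) (by have : (0 : ℝ) ≤ n := Nat.cast_nonneg n; linarith)
    have h4 := ih (k - 1) (by linarith) (by linarith)
    rw [show -(k - 1) = -k + 1 by ring, h3] at h4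
    have h5 : 0 < k := by have : (0 : ℝ) ≤ n := Nat.cast_nonneg n; linarith
    have h6 : (-1) ^ (n + 1) * (-k * Real.Gamma (-k)) =
        k * ((-1) ^ (n + 1 + 1) * Real.Gamma (-k)) := by ring
    rw [h6] at h4
    exact (mul_pos_iff_of_pos_left h5).1 h4

theorem setIntegral_Ioi_comp_affine (g : ℝ → ℂ) (α : ℝ) {ε : ℝ} (hε : 0 < ε) :
    ∫ x in Ioi α, g ((x - α) / ε) = ε * ∫ y in Ioi 0, g y := by
  have h1 := integral_sub_right_eq_self (μ := volume)
    (fun x : ℝ => (Ioi (0 : ℝ)).indicator g (x / ε)) α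
  have h2 := Measure.integral_comp_div (fun y => (Ioi (0 : ℝ)).indicator g y) ε
  rw [h2, abs_of_pos hε, integral_indicator measurableSet_Ioi, Complex.real_smul] at h1
  rw [← h1, ← integral_indicator measurableSet_Ioi]
  refine integral_congr_ae (ae_of_all _ fun x => ?_)
  by_cases hx : α < x
  · rw [indicator_of_mem (by exact hx)]
    simp only
    rw [indicator_of_mem]
    exact div_pos (sub_pos.2 hx) hε
  · rw [indicator_of_notMem (by exact hx)]
    simp only
    rw [indicator_of_notMem]
    intro h
    exact hx (sub_pos.1 ((div_pos_iff_of_pos_right hε).1 h))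

theorem iteratedDeriv_ofReal_pow (l p : ℕ) :
    iteratedDeriv p (fun y : ℝ => (y : ℂ) ^ l) =
      fun y : ℝ => (l.descFactorial p : ℂ) * (y : ℂ) ^ (l - p) := by
  induction p with
  | zero => simp
  | succ p ih =>
    rw [iteratedDeriv_succ, ih]
    ext y
    have h1 : HasDerivAt (fun y : ℝ => (y : ℂ) ^ (l - p))
        (((l - p : ℕ) : ℂ) * (y : ℂ) ^ (l - p - 1)) y := by
      simpa using ((hasDerivAt_pow (l - p) (y : ℂ)).comp_ofReal)
    rw [(h1.const_mul _).deriv, Nat.descFactorial_succ, show l - (p + 1) = l - p - 1 by omega]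
    push_cast
    ring

/-- The integrand `y^{l-k-1} (χ(y)² - 1)` of the regularized moments. -/
noncomputable def momentIntegrand (k : ℝ) (l : ℕ) (y : ℝ) : ℝ :=
  y ^ (-k - 1) * (y ^ l * (cutoff y ^ 2 - 1))

/-- The finite part of `∫₀^∞ y^{l-k-1} χ(y)² dy`, for `l < k`. -/
noncomputable def moment (k : ℝ) (l : ℕ) : ℝ := ∫ y in Ioi 0, momentIntegrand k l y

theorem abs_cutoff_sq_sub_one_le (y : ℝ) : |cutoff y ^ 2 - 1| ≤ 1 := by
  rw [abs_le]
  constructor <;> nlinarith [cutoff_nonneg y, cutoff_le_one y]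

/-- The factor `χ² - 1` vanishes on `(0, 1]`, which removes the singularity at zero; at infinity `l
< k` suffices. -/
theorem integrableOn_momentIntegrand {k : ℝ} {l : ℕ} (hl : (l : ℝ) < k) :
    IntegrableOn (momentIntegrand k l) (Ioi 0) := by
  have h1 : IntegrableOn ((Ioi (1 : ℝ)).indicator fun y : ℝ => y ^ ((l : ℝ) - k - 1)) (Ioi 0) := by
    rw [integrableOn_indicator_iff measurableSet_Ioi]
    exact (integrableOn_Ioi_rpow_of_lt (by linarith) one_pos).mono_set inter_subset_left
  refine Integrable.mono' h1 ?_ ?_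
  · refine ContinuousOn.aestronglyMeasurable ?_ measurableSet_Ioi
    refine ContinuousOn.mul ?_ (Continuous.continuousOn ?_)
    · exact ContinuousOn.rpow_const continuousOn_id fun x hx => Or.inl (ne_of_gt hx)
    · exact (continuous_pow l).mul ((cutoff_contDiff.continuous.pow 2).sub continuous_const)
  · refine (ae_restrict_iff' measurableSet_Ioi).2 (ae_of_all _ fun y hy => ?_)
    have hy0 : (0 : ℝ) < y := hy
    by_cases h2 : 1 < y
    · rw [indicator_of_mem (by exact h2), momentIntegrand, norm_mul, norm_mul, norm_pow,
        Real.norm_of_nonneg (Real.rpow_nonneg hy0.le _), Real.norm_of_nonneg hy0.le,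
        Real.norm_eq_abs]
      calc y ^ (-k - 1) * (y ^ l * |cutoff y ^ 2 - 1|)
          ≤ y ^ (-k - 1) * (y ^ l * 1) := by
            gcongr
            exact abs_cutoff_sq_sub_one_le y
        _ = y ^ ((l : ℝ) - k - 1) := by
            rw [mul_one, ← Real.rpow_natCast, ← Real.rpow_add hy0]; ring_nf
    · rw [indicator_of_notMem (by exact h2), momentIntegrand, cutoff_eq_one (by
        rw [abs_of_pos hy0]; exact not_lt.1 h2)]
      simp

/-- The regularized moments form a negative definite Hankel matrix. -/
theorem sum_moment_neg {k : ℝ} {m : ℕ} (hm : ∀ i j : Fin m, ((i + j : ℕ) : ℝ) < k)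
    {c : Fin m → ℂ} (hc : c ≠ 0) :
    (∑ i, ∑ j, starRingEnd ℂ (c i) * c j * (moment k (i + j) : ℂ)).re < 0 := by
  let p : ℝ → ℂ := fun y => ∑ i, c i * (y : ℂ) ^ (i : ℕ)
  -- Pointwise the double sum is `y^(-k-1) (χ² - 1) |p(y)|²` with `p` the polynomial with
  -- coefficients `c`, which is nonpositive.
  have hp : ∀ y : ℝ, ((∑ i : Fin m, ∑ j : Fin m, starRingEnd ℂ (c i) * c j *
      (momentIntegrand k (i + j) y : ℂ)) : ℂ).re =
      y ^ (-k - 1) * (cutoff y ^ 2 - 1) * ‖p y‖ ^ 2 := by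
    intro y
    have h1 : ((‖p y‖ ^ 2 : ℝ) : ℂ) = ∑ i : Fin m, ∑ j : Fin m, starRingEnd ℂ (c i) * c j *
        ((y : ℂ) ^ ((i : ℕ) + j)) := by
      rw [← Complex.normSq_eq_norm_sq, Complex.normSq_eq_conj_mul_self, map_sum,
        Finset.sum_mul_sum]
      refine Finset.sum_congr rfl fun i _ => Finset.sum_congr rfl fun j _ => ?_
      rw [map_mul, map_pow, Complex.conj_ofReal, pow_add]
      ring
    have h2 : (∑ i : Fin m, ∑ j : Fin m, starRingEnd ℂ (c i) * c j *
        (momentIntegrand k (i + j) y : ℂ)) =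
        ((y ^ (-k - 1) * (cutoff y ^ 2 - 1) * ‖p y‖ ^ 2 : ℝ) : ℂ) := by
      rw [Complex.ofReal_mul, h1, Finset.mul_sum]
      refine Finset.sum_congr rfl fun i _ => ?_
      rw [Finset.mul_sum]
      refine Finset.sum_congr rfl fun j _ => ?_
      unfold momentIntegrand
      push_cast
      ring
    rw [h2, Complex.ofReal_re]
  have hint : ∀ i j : Fin m, IntegrableOn (fun y => starRingEnd ℂ (c i) * c j *
      (momentIntegrand k (i + j) y : ℂ)) (Ioi 0) := fun i j =>
    ((integrableOn_momentIntegrand (hm i j)).ofReal).const_mul _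
  have hsum : IntegrableOn (fun y => ∑ i : Fin m, ∑ j : Fin m, starRingEnd ℂ (c i) * c j *
      (momentIntegrand k (i + j) y : ℂ)) (Ioi 0) :=
    integrable_finsetSum _ fun i _ => integrable_finsetSum _ fun j _ => hint i j
  have h3 : (∑ i : Fin m, ∑ j : Fin m, starRingEnd ℂ (c i) * c j * (moment k (i + j) : ℂ)) =
      ∫ y in Ioi 0, ∑ i : Fin m, ∑ j : Fin m, starRingEnd ℂ (c i) * c j *
        (momentIntegrand k (i + j) y : ℂ) := by
    rw [integral_finsetSum _ fun i _ => integrable_finsetSum _ fun j _ => hint i j]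
    refine Finset.sum_congr rfl fun i _ => ?_
    rw [integral_finsetSum _ fun j _ => hint i j]
    refine Finset.sum_congr rfl fun j _ => ?_
    rw [integral_const_mul, integral_complex_ofReal]
    rfl
  have h4 : (∑ i : Fin m, ∑ j : Fin m, starRingEnd ℂ (c i) * c j * (moment k (i + j) : ℂ)).re =
      ∫ y in Ioi 0, y ^ (-k - 1) * (cutoff y ^ 2 - 1) * ‖p y‖ ^ 2 := by
    rw [h3]
    have := integral_re hsum
    simp only [RCLike.re_eq_complex_re] at this
    rw [← this]
    simp only [hp]
  have hre : IntegrableOn (fun y => y ^ (-k - 1) * (cutoff y ^ 2 - 1) * ‖p y‖ ^ 2) (Ioi 0) := by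
    have := hsum.re
    simp only [RCLike.re_eq_complex_re, hp] at this
    exact this
  rw [h4, ← neg_pos, ← integral_neg]
  have hneg : IntegrableOn (fun y => -(y ^ (-k - 1) * (cutoff y ^ 2 - 1) * ‖p y‖ ^ 2)) (Ioi 0) :=
    hre.neg
  rw [setIntegral_pos_iff_support_of_nonneg_ae ?_ hneg]
  · let P : Polynomial ℂ := ∑ i : Fin m, Polynomial.C (c i) * Polynomial.X ^ (i : ℕ)
    have hP : P ≠ 0 := by
      intro h0
      refine hc (funext fun i => ?_)
      have h5 : P.coeff i = c i := by
        simp only [P, Polynomial.finsetSum_coeff, Polynomial.coeff_C_mul, Polynomial.coeff_X_pow]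
        rw [Finset.sum_eq_single i]
        · simp
        · intro j _ hj
          rw [if_neg (fun h => hj (Fin.ext h.symm)), mul_zero]
        · simp
      rw [← h5, h0]
      simp
    have heval : ∀ y : ℝ, P.eval (y : ℂ) = p y := by
      intro y
      simp [P, p, Polynomial.eval_finsetSum]
    have hfin : (((↑) : ℝ → ℂ) ⁻¹' {z | P.IsRoot z}).Finite :=
      (Polynomial.finite_setOfPred_isRoot hP).preimage Complex.ofReal_injective.injOn
    -- Strictness: beyond `2` the cutoff vanishes, so the integrand is nonzero there except at the
    -- finitely many roots of `p`.
    have hsub : Ioi (2 : ℝ) \ (((↑) : ℝ → ℂ) ⁻¹' {z | P.IsRoot z}) ⊆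
        Function.support (fun y => -(y ^ (-k - 1) * (cutoff y ^ 2 - 1) * ‖p y‖ ^ 2)) ∩ Ioi 0 := by
      rintro y ⟨hy, hroot⟩
      have hy2 : (2 : ℝ) < y := hy
      have hy0 : (0 : ℝ) < y := by linarith
      refine ⟨?_, hy0⟩
      have hne : p y ≠ 0 := by
        rw [← heval]; exact hroot
      rw [Function.mem_support, cutoff_eq_zero (by rw [abs_of_pos hy0]; exact hy2.le)]
      have h6 : 0 < y ^ (-k - 1) := Real.rpow_pos_of_pos hy0 _
      have h7 : 0 < ‖p y‖ ^ 2 := pow_pos (norm_pos_iff.2 hne) 2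
      have h8 := mul_pos h6 h7
      norm_num
      exact ⟨h6.ne', hne⟩
    refine lt_of_lt_of_le ?_ (measure_mono hsub)
    rw [measure_sdiff_null (hfin.measure_zero _)]
    simp
  · refine (ae_restrict_iff' measurableSet_Ioi).2 (ae_of_all _ fun y hy => ?_)
    have h6 : 0 ≤ y ^ (-k - 1) := Real.rpow_nonneg (le_of_lt hy) _
    have h7 : 0 ≤ ‖p y‖ ^ 2 := by positivity
    have h8 : 0 ≤ 1 - cutoff y ^ 2 := by nlinarith [cutoff_nonneg y, cutoff_le_one y]
    have h9 := mul_nonneg (mul_nonneg h6 h8) h7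
    simp only [Pi.zero_apply]
    linarith

/-! ### Asymptotics of `σ` on products of trial functions -/

section Trial

variable (r α : ℝ) (l : ℕ)

/-- The profile of a product of two trial functions. -/
noncomputable def trialProfile (ε y : ℝ) : ℂ :=
  (Real.exp (r * (ε * y)) : ℂ) * ((y : ℂ) ^ l * (cutoff y : ℂ) ^ 2)

theorem trialProfile_eq_zero (ε : ℝ) {y : ℝ} (hy : 2 ≤ |y|) : trialProfile r l ε y = 0 := by
  rw [trialProfile, cutoff_eq_zero hy]
  simp

theorem pow_mul_cutoff_sq_contDiff : ContDiff ℝ ∞ fun y : ℝ => (y : ℂ) ^ l * (cutoff y : ℂ) ^ 2 :=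
  (Complex.ofRealCLM.contDiff.pow l).mul (cutoff_complex_contDiff.pow 2)

theorem exp_mul_contDiff : ContDiff ℝ ∞ fun z : ℝ => (Real.exp (r * z) : ℂ) := by
  have h1 : ContDiff ℝ ∞ fun z : ℝ => Real.exp (r * z) := by fun_prop
  exact Complex.ofRealCLM.contDiff.comp h1

theorem trialProfile_contDiff (ε : ℝ) : ContDiff ℝ ∞ (trialProfile r l ε) :=
  ((exp_mul_contDiff r).comp (contDiff_const.mul contDiff_id)).mul (pow_mul_cutoff_sq_contDiff l)

/-- The product of two trial functions concentrated at the scale `ε` around `α`. -/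
noncomputable def trialProduct (ε : ℝ) (hε : 0 < ε) : 𝓢(ℝ, ℂ) :=
  HasCompactSupport.toSchwartzMap (f := fun x => trialProfile r l ε ((x - α) / ε))
    (hasCompactSupport_of_eq_zero (a := α) (R := 2 * ε) fun x hx => trialProfile_eq_zero r l ε (by
      rwa [abs_div, abs_of_pos hε, le_div_iff₀ hε]))
    ((trialProfile_contDiff r l ε).comp ((contDiff_id.sub contDiff_const).div_const ε))

theorem trialProduct_apply (ε : ℝ) (hε : 0 < ε) (x : ℝ) :
    trialProduct r α l ε hε x = trialProfile r l ε ((x - α) / ε) := rfl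

/-- The exponentials cancel, and `χ = 1` near `α`, so the `n`-jet is that of the monomial `y^l`. As
`l ≤ n`, subtracting the Taylor polynomial leaves exactly `y^l (χ² - 1)`; the change of variable
then produces `ε^(-k)` with no error term. -/
theorem sigmaZero_trialProduct {n : ℕ} {k : ℝ} (hl : l ≤ n) (ε : ℝ) (hε : 0 < ε) :
    sigmaZero n k r α (trialProduct r α l ε hε) =
      ((ε ^ (-k) : ℝ) : ℂ) * ((moment k l / Real.Gamma (-k) : ℝ) : ℂ) := by
  have hv : ∀ x : ℝ, (Real.exp (-(r * (x - α))) : ℂ) * trialProduct r α l ε hε x =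
      (((x - α) / ε : ℝ) : ℂ) ^ l * (cutoff ((x - α) / ε) : ℂ) ^ 2 := by
    intro x
    rw [trialProduct_apply, trialProfile, ← mul_assoc, mul_div_cancel₀ _ hε.ne',
      ← Complex.ofReal_mul, ← Real.exp_add, neg_add_cancel, Real.exp_zero, Complex.ofReal_one,
      one_mul]
  have hjet : ∀ p, iteratedDeriv p (fun x : ℝ => (((x - α) / ε : ℝ) : ℂ) ^ l *
      (cutoff ((x - α) / ε) : ℂ) ^ 2) α =
      (ε : ℂ)⁻¹ ^ l * ((l.descFactorial p : ℂ) * 0 ^ (l - p)) := by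
    intro p
    have h1 : (fun x : ℝ => (((x - α) / ε : ℝ) : ℂ) ^ l * (cutoff ((x - α) / ε) : ℂ) ^ 2) =ᶠ[𝓝 α]
        fun x : ℝ => (ε : ℂ)⁻¹ ^ l * ((x - α : ℝ) : ℂ) ^ l := by
      filter_upwards [Metric.closedBall_mem_nhds α hε] with x hx
      have hx' : |x - α| ≤ ε := by simpa [Real.dist_eq] using hx
      rw [cutoff_eq_one (by rwa [abs_div, abs_of_pos hε, div_le_one hε])]
      push_cast
      rw [div_pow, inv_pow]
      ring
    rw [h1.iteratedDeriv_eq p, iteratedDeriv_const_mul_field]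
    have h2 := congrFun (iteratedDeriv_comp_sub_const p (fun y : ℝ => (y : ℂ) ^ l) α) α
    rw [h2, iteratedDeriv_ofReal_pow]
    simp
  have hT : ∀ x : ℝ, ∑ p ∈ Finset.range (n + 1),
      iteratedDeriv p (fun x : ℝ => (((x - α) / ε : ℝ) : ℂ) ^ l *
        (cutoff ((x - α) / ε) : ℂ) ^ 2) α / (p.factorial : ℂ) * ((x - α : ℝ) : ℂ) ^ p =
      (((x - α) / ε : ℝ) : ℂ) ^ l := by
    intro x
    rw [Finset.sum_eq_single_of_mem l (Finset.mem_range.2 (by omega))]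
    · rw [hjet, Nat.descFactorial_self, Nat.sub_self, pow_zero, mul_one, mul_div_assoc, div_self
        (by exact_mod_cast l.factorial_ne_zero)]
      push_cast
      rw [div_pow, inv_pow]
      ring
    · intro p _ hp
      rw [hjet]
      rcases lt_or_gt_of_ne hp with h | h
      · rw [zero_pow (by omega)]; simp
      · rw [Nat.descFactorial_of_lt h]; simp
  unfold sigmaZero
  simp only [hv, hT]
  have hint : ∫ x in Ioi α, (((x - α) ^ (-k - 1) : ℝ) : ℂ) *
      ((((x - α) / ε : ℝ) : ℂ) ^ l * (cutoff ((x - α) / ε) : ℂ) ^ 2 -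
        (((x - α) / ε : ℝ) : ℂ) ^ l) =
      ∫ x in Ioi α, (fun y : ℝ => ((ε ^ (-k - 1) : ℝ) : ℂ) * (momentIntegrand k l y : ℂ))
        ((x - α) / ε) := by
    refine setIntegral_congr_fun measurableSet_Ioi fun x hx => ?_
    have hx0 : 0 < x - α := sub_pos.2 hx
    have h3 : (x - α) ^ (-k - 1) = ε ^ (-k - 1) * ((x - α) / ε) ^ (-k - 1) := by
      rw [← Real.mul_rpow hε.le (by positivity), mul_div_cancel₀ _ hε.ne']
    simp only [momentIntegrand]
    rw [h3]
    push_cast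
    ring
  rw [hint, setIntegral_Ioi_comp_affine
    (fun y : ℝ => ((ε ^ (-k - 1) : ℝ) : ℂ) * (momentIntegrand k l y : ℂ)) α hε, integral_const_mul, integral_complex_ofReal]
  have h4 : ε ^ (-k) = ε * ε ^ (-k - 1) := by
    rw [show -k = 1 + (-k - 1) by ring, Real.rpow_add hε, Real.rpow_one,
      show 1 + (-k - 1) - 1 = -k - 1 by ring]
  rw [h4, ← moment]
  push_cast
  ring

/-- The `ε`-dependence sits only in `e^{rεy}`: its derivatives carry powers `ε^q ≤ 1`, and `εy`
stays in `[-2, 2]` on the support. -/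
theorem exists_bound_trialProfile (n : ℕ) :
    ∃ M, ∀ ε, 0 < ε → ε < 1 → ∀ p ≤ n, ∀ y, ‖iteratedDeriv p (trialProfile r l ε) y‖ ≤ M := by
  have hg := pow_mul_cutoff_sq_contDiff l
  obtain ⟨B, hB0, hB⟩ := exists_bound_iteratedDeriv hg
    (hasCompactSupport_of_eq_zero (a := 0) (R := 2) fun y hy => by
      rw [cutoff_eq_zero (by simpa using hy)]; simp) n
  have hE := exp_mul_contDiff r
  have hA : ∃ A, ∀ p ≤ n, ∀ z ∈ Icc (-2 : ℝ) 2,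
      ‖iteratedDeriv p (fun z : ℝ => (Real.exp (r * z) : ℂ)) z‖ ≤ A := by
    have h1 : ∀ p : ℕ, ∃ A, ∀ z ∈ Icc (-2 : ℝ) 2,
        ‖iteratedDeriv p (fun z : ℝ => (Real.exp (r * z) : ℂ)) z‖ ≤ A := fun p =>
      isCompact_Icc.exists_bound_of_continuousOn
        (hE.continuous_iteratedDeriv p (by exact_mod_cast le_top)).continuousOn
    choose A hA using h1
    have hA0 : ∀ p, 0 ≤ A p := fun p => (norm_nonneg _).trans (hA p 0 (by norm_num))
    refine ⟨∑ p ∈ Finset.range (n + 1), A p, fun p hp z hz => (hA p z hz).trans ?_⟩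
    exact Finset.single_le_sum (fun p _ => hA0 p) (Finset.mem_range.2 (by omega))
  obtain ⟨A, hA⟩ := hA
  have hA0 : 0 ≤ A := (norm_nonneg _).trans (hA 0 (by omega) 0 (by norm_num))
  refine ⟨2 ^ n * (A * B), fun ε hε hε1 p hp y => ?_⟩
  by_cases hy : y ∈ Icc (-2 : ℝ) 2
  · have hEε : ContDiff ℝ ∞ fun y : ℝ => (Real.exp (r * (ε * y)) : ℂ) :=
      hE.comp (contDiff_const.mul contDiff_id)
    refine norm_iteratedDeriv_mul_le_of_le hEε hg (fun q hq => ?_) (fun q hq => hB q hq y) p hp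
    have h2 := iteratedDeriv_comp_affine hE q 0 ε y
    simp only [zero_add] at h2
    rw [h2, norm_mul, norm_pow, Complex.norm_real, Real.norm_of_nonneg hε.le]
    have h3 := hA q hq (ε * y) (by
      rw [mem_Icc, ← abs_le, abs_mul, abs_of_pos hε]
      have := abs_le.2 hy
      nlinarith [abs_nonneg y])
    calc ε ^ q * ‖iteratedDeriv q (fun z : ℝ => (Real.exp (r * z) : ℂ)) (ε * y)‖
        ≤ 1 * A := by
          gcongr
          exact pow_le_one₀ hε.le hε1.le
      _ = A := one_mul A
  · rw [iteratedDeriv_eq_zero_of_notMem_tsupport p fun h => hy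
      (tsupport_subset_of_eq_zero (fun y hy => trialProfile_eq_zero r l ε hy) h), norm_zero]
    positivity

variable {r α} {n : ℕ} {k : ℝ} {σ τ : 𝓢'(ℝ, ℂ)} {s : ℝ → ℝ}

theorem PointSingularity.tendsto_trialProduct (H : PointSingularity n k r α σ τ s) (hl : l ≤ n)
    (φ : ℝ → 𝓢(ℝ, ℂ)) (hφ : ∀ ε (hε : 0 < ε), φ ε = trialProduct r α l ε hε) :
    Tendsto (fun ε => ((ε ^ k : ℝ) : ℂ) * σ (φ ε)) (𝓝[>] 0)
      (𝓝 ((moment k l / Real.Gamma (-k) : ℝ) : ℂ)) := by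
  obtain ⟨M, hM⟩ := exists_bound_trialProfile r l n
  have h1 := H.lessSingular.tendsto (R := 2) (M := M) φ (trialProfile r l) (by
    filter_upwards [Ioo_mem_nhdsGT one_pos] with ε hε
    refine ⟨trialProfile_contDiff r l ε,
      tsupport_subset_of_eq_zero fun y hy => trialProfile_eq_zero r l ε hy, hM ε hε.1 hε.2,
      fun x => ?_⟩
    rw [hφ ε hε.1]
    rfl)
  have h2 := h1.const_add ((moment k l / Real.Gamma (-k) : ℝ) : ℂ)
  rw [add_zero] at h2
  refine h2.congr' ?_
  filter_upwards [self_mem_nhdsWithin] with ε hε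
  have hε0 : (0 : ℝ) < ε := hε
  rw [H.decomp, mul_add, hφ ε hε0, sigmaZero_trialProduct r α l hl ε hε0, ← mul_assoc,
    ← Complex.ofReal_mul, ← Real.rpow_add hε0, add_neg_cancel, Real.rpow_zero, Complex.ofReal_one,
    one_mul]

end Trial

/-! ### Weierstrass approximation by Laplace transforms, with contact -/

section Approximation

/-- Weierstrass approximation with contact of order `N` at an interior point. -/
theorem exists_polynomial_near_of_contact {F : ℝ → ℝ} {y₀ : ℝ} (hy₀ : y₀ ∈ Ioo (0 : ℝ) 1) {N : ℕ} (hF : ContinuousOn F (Icc 0 1)) (hF' : ContDiffOn ℝ N F (Ioo 0 1)) {η : ℝ}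
    (hη : 0 < η) :
    ∃ P : Polynomial ℝ, ∀ y ∈ Icc (0 : ℝ) 1, |F y - P.eval y| ≤ η * |y - y₀| ^ N := by
  let T : Polynomial ℝ := ∑ p ∈ Finset.range (N + 1),
    Polynomial.C ((p.factorial : ℝ)⁻¹ * iteratedDerivWithin p F (Ioo 0 1) y₀) *
      (Polynomial.X - Polynomial.C y₀) ^ p
  have hT : ∀ y, taylorWithinEval F N (Ioo 0 1) y₀ y = T.eval y := by
    intro y
    rw [taylor_within_apply, Polynomial.eval_finsetSum]
    refine Finset.sum_congr rfl fun p _ => ?_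
    simp
    ring
  have hself : T.eval y₀ = F y₀ := by rw [← hT, taylorWithinEval_self]
  have ho : (fun y => F y - T.eval y) =o[𝓝 y₀] fun y => (y - y₀) ^ N := by
    have := taylor_isLittleO (convex_Ioo (0 : ℝ) 1) hy₀ hF'
    rw [isOpen_Ioo.nhdsWithin_eq hy₀] at this
    simpa only [hT] using this
  -- The contact factor is divided out before approximating. The numerator vanishes at `y₀`, so `G
  -- y₀ = 0` even under division by zero, and by the Taylor estimate this is the continuous
  -- extension.
  let G : ℝ → ℝ := fun y => (F y - T.eval y) / (y - y₀) ^ N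
  have hG0 : G y₀ = 0 := by simp [G, hself]
  have hGmul : ∀ y, F y - T.eval y = (y - y₀) ^ N * G y := by
    intro y
    by_cases hy : y = y₀
    · rw [hy, hself, hG0]; simp
    · have : (y - y₀) ^ N ≠ 0 := pow_ne_zero _ (sub_ne_zero.2 hy)
      simp only [G]
      field_simp
  have hGc : ContinuousOn G (Icc 0 1) := by
    intro y hy
    by_cases h : y = y₀
    · subst h
      refine ContinuousAt.continuousWithinAt ?_
      have := ho.tendsto_div_nhds_zero
      unfold ContinuousAt
      rw [hG0]
      exact this
    · refine ContinuousWithinAt.div ((hF y hy).sub T.continuous.continuousWithinAt) ?_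
        (pow_ne_zero _ (sub_ne_zero.2 h))
      exact ((continuous_id.sub continuous_const).pow N).continuousWithinAt
  obtain ⟨P, hP⟩ := exists_polynomial_near_of_continuousOn 0 1 G hGc η hη
  refine ⟨T + (Polynomial.X - Polynomial.C y₀) ^ N * P, fun y hy => ?_⟩
  have h1 : F y - (T + (Polynomial.X - Polynomial.C y₀) ^ N * P).eval y =
      (y - y₀) ^ N * (G y - P.eval y) := by
    simp only [Polynomial.eval_add, Polynomial.eval_mul, Polynomial.eval_pow, Polynomial.eval_sub,
      Polynomial.eval_X, Polynomial.eval_C]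
    linear_combination hGmul y
  rw [h1, abs_mul, abs_pow, mul_comm, abs_sub_comm]
  gcongr
  exact (hP y hy).le

theorem abs_exp_neg_sub_exp_neg_le {x a : ℝ} (hx : 0 ≤ x) (ha : 0 ≤ a) :
    |Real.exp (-x) - Real.exp (-a)| ≤ |x - a| := by
  have key : ∀ x a : ℝ, 0 ≤ x → x ≤ a → |Real.exp (-x) - Real.exp (-a)| ≤ |x - a| := by
    intro x a hx hxa
    rw [abs_of_nonneg (sub_nonneg.2 (Real.exp_le_exp.2 (by linarith))), abs_sub_comm,
      abs_of_nonneg (sub_nonneg.2 hxa)]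
    have h1 : Real.exp (-a) = Real.exp (-x) * Real.exp (-(a - x)) := by
      rw [← Real.exp_add]; ring_nf
    have h2 : 1 - (a - x) ≤ Real.exp (-(a - x)) := by
      have := Real.add_one_le_exp (-(a - x)); linarith
    have h3 : Real.exp (-x) ≤ 1 := Real.exp_le_one_iff.2 (by linarith)
    have h4 : 0 < Real.exp (-x) := Real.exp_pos _
    rw [h1]
    nlinarith
  rcases le_total x a with h | h
  · exact key x a hx h
  · rw [abs_sub_comm, abs_sub_comm x]
    exact key a x ha h

/-- Approximation by Laplace transforms of test functions, with contact of order `N` at `α`. -/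
theorem exists_laplace_near {g : ℝ → ℝ} (hg : ContDiff ℝ ∞ g) {b : ℝ} (hb : ∀ x, b ≤ x → g x = 0)
    (hg0 : g 0 = 0) {α : ℝ} (hα : 0 < α) {N : ℕ} {η : ℝ} (hη : 0 < η) :
    ∃ (f : Test) (v : ℝ → ℝ), (∀ x, laplace f x = (v x : ℂ)) ∧
      ∀ x, 0 < x → |g x - v x| ≤ η * |x - α| ^ N * bumpLaplace x := by
  -- The substitution `y = e^{-x}`. For small `y > 0` the value is zero because `g` vanishes beyond
  -- `b`; at `y = 0` the convention `Real.log 0 = 0` gives a multiple of `g 0 = 0`, so `F` is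
  -- continuous up to the endpoint.
  let F : ℝ → ℝ := fun y => g (-Real.log y) / bumpLaplace (-Real.log y)
  have hsm : ContDiffOn ℝ ∞ F (Ioi 0) := by
    have h1 : ContDiff ℝ ∞ fun x => g x / bumpLaplace x :=
      hg.div bumpLaplace_contDiff fun x => (bumpLaplace_pos x).ne'
    have h2 : ContDiffOn ℝ ∞ (fun y => -Real.log y) (Ioi 0) :=
      (Real.contDiffOn_log.mono fun y hy => ne_of_gt hy).neg
    exact h1.comp_contDiffOn h2
  have hcont : ContinuousOn F (Icc 0 1) := by
    intro y hy
    rcases hy.1.eq_or_lt with h | h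
    · subst h
      have hF0 : F =ᶠ[𝓝[Icc 0 1] 0] fun _ => 0 := by
        have : Iio (Real.exp (-b)) ∈ 𝓝[Icc 0 1] (0 : ℝ) :=
          mem_nhdsWithin_of_mem_nhds (Iio_mem_nhds (Real.exp_pos _))
        filter_upwards [this, self_mem_nhdsWithin] with y hy hy1
        rcases hy1.1.eq_or_lt with h | h
        · subst h; simp [F, hg0]
        · have h3 : b ≤ -Real.log y := by
            have := (Real.log_lt_iff_lt_exp h).2 hy
            linarith
          simp [F, hb _ h3]
      have hF00 : F 0 = 0 := by simp [F, hg0]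
      unfold ContinuousWithinAt
      rw [hF00]
      exact tendsto_const_nhds.congr' hF0.symm
    · exact (hsm.continuousOn.continuousAt (Ioi_mem_nhds h)).continuousWithinAt
  have hy₀ : Real.exp (-α) ∈ Ioo (0 : ℝ) 1 :=
    ⟨Real.exp_pos _, Real.exp_lt_one_iff.2 (by linarith)⟩
  obtain ⟨P, hP⟩ := exists_polynomial_near_of_contact hy₀ hcont
    ((hsm.of_le (by exact_mod_cast le_top)).mono fun y hy => hy.1) hη
  obtain ⟨f, hf⟩ := exists_laplace_eq_eval P
  refine ⟨f, fun x => P.eval (Real.exp (-x)) * bumpLaplace x, hf, fun x hx => ?_⟩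
  have h4 := hP (Real.exp (-x)) ⟨(Real.exp_pos _).le, Real.exp_le_one_iff.2 (by linarith)⟩
  have hR := bumpLaplace_pos x
  have h5 : g x - P.eval (Real.exp (-x)) * bumpLaplace x =
      (F (Real.exp (-x)) - P.eval (Real.exp (-x))) * bumpLaplace x := by
    simp only [F, Real.log_exp, neg_neg]
    field_simp
  rw [h5, abs_mul, abs_of_pos hR]
  exact mul_le_mul_of_nonneg_right (h4.trans (mul_le_mul_of_nonneg_left (pow_le_pow_left₀
    (abs_nonneg _) (abs_exp_neg_sub_exp_neg_le hx.le hα.le) N) hη.le)) hR.le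

theorem exists_bumpLaplace_le (n : ℕ) :
    ∃ C, 0 ≤ C ∧ ∀ x, 0 < x → bumpLaplace x ≤ C * ((1 + |x|) ^ (n + 3))⁻¹ := by
  obtain ⟨C, hC0, hC⟩ := exists_decay (laplaceSchwartz bumpTest) (n + 3)
  refine ⟨C, hC0, fun x hx => ?_⟩
  have h1 := hC x
  rwa [laplaceSchwartz_apply _ (by linarith), laplace_bumpTest, Complex.norm_real,
    Real.norm_of_nonneg (bumpLaplace_pos x).le] at h1

end Approximation

/-! ### Trial functions and their approximation -/

section TrialFunctions

variable {n : ℕ} {k r α : ℝ} {σ τ : 𝓢'(ℝ, ℂ)} {s : ℝ → ℝ}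

/-- The trial function `e^{r(x-α)/2} y^i χ(y)` with `y = (x - α)/ε`. -/
noncomputable def trial (r α ε : ℝ) (i : ℕ) (x : ℝ) : ℝ :=
  Real.exp (r * (x - α) / 2) * (((x - α) / ε) ^ i * cutoff ((x - α) / ε))

theorem trial_contDiff (r α ε : ℝ) (i : ℕ) : ContDiff ℝ ∞ (trial r α ε i) := by
  have h1 : ContDiff ℝ ∞ fun x : ℝ => (x - α) / ε := (contDiff_id.sub contDiff_const).div_const ε
  have h2 : ContDiff ℝ ∞ fun x : ℝ => Real.exp (r * (x - α) / 2) := by fun_prop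
  exact h2.mul ((h1.pow i).mul (cutoff_contDiff.comp h1))

theorem trial_eq_zero (r α : ℝ) {ε : ℝ} (hε : 0 < ε) (i : ℕ) {x : ℝ} (hx : 2 * ε ≤ |x - α|) :
    trial r α ε i x = 0 := by
  rw [trial, cutoff_eq_zero, mul_zero, mul_zero]
  rwa [abs_div, abs_of_pos hε, le_div_iff₀ hε]

theorem exists_abs_trial_le (r α : ℝ) {ε : ℝ} (hε : 0 < ε) (i : ℕ) :
    ∃ B, ∀ x, |trial r α ε i x| ≤ B :=
  (trial_contDiff r α ε i).continuous.bounded_above_of_compact_support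
    (HasCompactSupport.intro (isCompact_closedBall α (2 * ε)) fun x hx => trial_eq_zero r α hε i (by
      rw [Metric.mem_closedBall, Real.dist_eq, not_le] at hx
      exact hx.le))

theorem trial_mul_trial (r α : ℝ) {ε : ℝ} (hε : 0 < ε) (i j : ℕ) (x : ℝ) :
    trialProduct r α (i + j) ε hε x = ((trial r α ε i x * trial r α ε j x : ℝ) : ℂ) := by
  have h1 : Real.exp (r * (x - α)) = Real.exp (r * (x - α) / 2) * Real.exp (r * (x - α) / 2) := by
    rw [← Real.exp_add]; ring_nf
  rw [trialProduct_apply, trialProfile, mul_div_cancel₀ _ hε.ne', h1, trial, trial]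
  push_cast
  ring

/-- The form of `σ` on products of trial functions is approximated by the form on Laplace
transforms of test functions. -/
theorem PointSingularity.exists_test_near (H : PointSingularity n k r α σ τ s) {ε : ℝ} (hε : 0 < ε)
    (hεα : 2 * ε ≤ α) (m : ℕ) {δ : ℝ} (hδ : 0 < δ) :
    ∃ f : ℕ → Test, ∀ i < m, ∀ j < m,
      ‖σ (laplaceSchwartz (laplaceConv (conjTest (f i)) (f j))) -
        σ (trialProduct r α (i + j) ε hε)‖ ≤ δ := by
  obtain ⟨C, hC0, hC⟩ := exists_bumpLaplace_le n
  have hB : ∃ B, 0 ≤ B ∧ ∀ i < m, ∀ x, |trial r α ε i x| ≤ B := by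
    choose B hB using fun i => exists_abs_trial_le r α hε i
    have hB0 : ∀ i, 0 ≤ B i := fun i => (abs_nonneg _).trans (hB i 0)
    exact ⟨∑ i ∈ Finset.range m, B i, Finset.sum_nonneg fun i _ => hB0 i, fun i hi x =>
      (hB i x).trans (Finset.single_le_sum (fun i _ => hB0 i) (Finset.mem_range.2 hi))⟩
  obtain ⟨B, hB0, hB⟩ := hB
  set I : ℝ := ∫ x in Ioi 0, |s x| * weight n α x with hI
  have hI0 : 0 ≤ I := integral_nonneg fun x => mul_nonneg (abs_nonneg _) (weight_nonneg _ _ _)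
  -- Write `g` for a trial function and `v` for its approximant. A product error is split as `v_i
  -- (g_j - v_j) + (g_i - v_i) g_j`, with `|g| ≤ B`, `|g - v| ≤ η C` times the weight, and `|v| ≤ B
  -- + C (1 + |α|)^(n+1)`; the last bound uses `η ≤ 1`.
  set D : ℝ := C * (2 * B + C * (1 + |α|) ^ (n + 1)) with hD
  have hD0 : 0 ≤ D := by positivity
  obtain ⟨η, hη, hη1, hηδ⟩ : ∃ η > 0, η ≤ 1 ∧ η * D * I ≤ δ := by
    refine ⟨min 1 (δ / (D * I + 1)), lt_min one_pos (by positivity), min_le_left _ _, ?_⟩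
    calc min 1 (δ / (D * I + 1)) * D * I = min 1 (δ / (D * I + 1)) * (D * I) := by ring
      _ ≤ δ / (D * I + 1) * (D * I + 1) := by
        gcongr
        · exact min_le_right _ _
        · linarith
      _ = δ := by field_simp
  have hg0 : ∀ i, trial r α ε i 0 = 0 := fun i => trial_eq_zero r α hε i (by
    rw [zero_sub, abs_neg, abs_of_pos H.pos_point]; exact hεα)
  have hgb : ∀ i x, α + 2 * ε ≤ x → trial r α ε i x = 0 := fun i x hx =>
    trial_eq_zero r α hε i (by rw [abs_of_nonneg (by linarith)]; linarith)
  choose f v hf hv using fun i => exists_laplace_near (trial_contDiff r α ε i) (hgb i) (hg0 i)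
    H.pos_point (N := n + 1) hη
  refine ⟨f, fun i hi j hj => ?_⟩
  let u : 𝓢(ℝ, ℂ) := laplaceSchwartz (laplaceConv (conjTest (f i)) (f j)) -
    trialProduct r α (i + j) ε hε
  have hu : ∀ x, 0 < x → u x =
      ((v i x * v j x - trial r α ε i x * trial r α ε j x : ℝ) : ℂ) := by
    intro x hx
    simp only [u, sub_apply]
    rw [laplaceSchwartz_apply _ (by linarith), laplace_laplaceConv, laplace_conjTest, hf, hf,
      Complex.conj_ofReal, trial_mul_trial]
    push_cast
    rfl
  have hK : ∀ x, 0 < x → ‖u x‖ ≤ η * D * weight n α x := by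
    intro x hx
    rw [hu x hx, Complex.norm_real, Real.norm_eq_abs]
    have hR : |x - α| ^ (n + 1) * bumpLaplace x ≤ C * weight n α x := by
      calc |x - α| ^ (n + 1) * bumpLaplace x
          ≤ |x - α| ^ (n + 1) * (C * ((1 + |x|) ^ (n + 3))⁻¹) := by
            gcongr; exact hC x hx
        _ = C * weight n α x := by unfold weight; ring
    have hw1 : weight n α x ≤ (1 + |α|) ^ (n + 1) := by
      refine (weight_le_sq n α x).trans (mul_le_of_le_one_right (by positivity) ?_)
      exact inv_le_one_of_one_le₀ (one_le_pow₀ (by linarith [abs_nonneg x]))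
    have hw0 := weight_nonneg n α x
    have hd : ∀ i, |trial r α ε i x - v i x| ≤ η * (C * weight n α x) := fun i =>
      (hv i x hx).trans (by rw [mul_assoc]; gcongr)
    have hvi : |v i x| ≤ B + C * (1 + |α|) ^ (n + 1) := by
      have h1 : |v i x| ≤ |trial r α ε i x| + |trial r α ε i x - v i x| := by
        have := abs_sub (trial r α ε i x) (trial r α ε i x - v i x)
        rwa [sub_sub_cancel] at this
      have h2 : η * (C * weight n α x) ≤ 1 * (C * (1 + |α|) ^ (n + 1)) := by gcongr
      linarith [hB i hi x, hd i]
    have h3 : v i x * v j x - trial r α ε i x * trial r α ε j x =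
        -(v i x * (trial r α ε j x - v j x) +
          (trial r α ε i x - v i x) * trial r α ε j x) := by ring
    rw [h3, abs_neg]
    calc |v i x * (trial r α ε j x - v j x) + (trial r α ε i x - v i x) * trial r α ε j x|
        ≤ |v i x| * |trial r α ε j x - v j x| + |trial r α ε i x - v i x| * |trial r α ε j x| := by
          rw [← abs_mul, ← abs_mul]; exact abs_add_le _ _
      _ ≤ (B + C * (1 + |α|) ^ (n + 1)) * (η * (C * weight n α x)) +
          η * (C * weight n α x) * B := by
          gcongr
          · exact hd j
          · exact hd i
          · exact hB j hj x
      _ = η * D * weight n α x := by rw [hD]; ring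
  -- The contact of the approximation makes `σ u` an integral against `s`, even though neither of
  -- the two terms of `u` need vanish at `α`.
  have hO : u =O[𝓝 α] fun x => (x - α) ^ (n + 1) := by
    refine Asymptotics.IsBigO.of_bound (η * D) ?_
    filter_upwards [Ioi_mem_nhds H.pos_point] with x hx
    refine (hK x hx).trans ?_
    rw [norm_pow, Real.norm_eq_abs]
    gcongr
    exact weight_le_pow _ _ _
  rw [← map_sub]
  change ‖σ u‖ ≤ δ
  rw [H.eq_integral u hO]
  exact ((H.integrableOn_mul u.continuous hK).2).trans hηδ

end TrialFunctions

/-! ### Gram forms and their perturbation -/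

/-- The sesquilinear form `∑ c̄ᵢ cⱼ Aᵢⱼ`. -/
noncomputable def gramForm {m : ℕ} (A : Fin m → Fin m → ℂ) (c : Fin m → ℂ) : ℂ :=
  ∑ i, ∑ j, starRingEnd ℂ (c i) * c j * A i j

/-- Positive definiteness is stable under small perturbations of the entries. -/
theorem exists_perturbation_pos {m : ℕ} (G : Fin m → Fin m → ℂ)
    (hG : ∀ c, c ≠ 0 → 0 < (gramForm G c).re) :
    ∃ δ > 0, ∀ A : Fin m → Fin m → ℂ, (∀ i j, ‖A i j - G i j‖ ≤ δ) →
      ∀ c, c ≠ 0 → 0 < (gramForm A c).re := by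
  have hcont : Continuous fun c : Fin m → ℂ => (gramForm G c).re := by
    unfold gramForm
    refine Complex.continuous_re.comp ?_
    refine continuous_finsetSum _ fun i _ => continuous_finsetSum _ fun j _ => ?_
    exact ((Complex.continuous_conj.comp (continuous_apply i)).mul (continuous_apply j)).mul
      continuous_const
  have hμ : ∃ μ > 0, ∀ c : Fin m → ℂ, ‖c‖ = 1 → μ ≤ (gramForm G c).re := by
    -- The unit sphere is empty when `m = 0`; otherwise compactness provides a positive minimum.
    rcases (Metric.sphere (0 : Fin m → ℂ) 1).eq_empty_or_nonempty with h | h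
    · refine ⟨1, one_pos, fun c hc => ?_⟩
      have : c ∈ Metric.sphere (0 : Fin m → ℂ) 1 := by simpa using hc
      rw [h] at this
      exact this.elim
    · obtain ⟨c₀, hc₀, hmin⟩ := (isCompact_sphere (0 : Fin m → ℂ) 1).exists_isMinOn h
        hcont.continuousOn
      refine ⟨_, hG c₀ ?_, fun c hc => hmin (by simpa using hc)⟩
      rintro rfl
      simp at hc₀
  obtain ⟨μ, hμ0, hμ⟩ := hμ
  -- On the unit sphere the `m²` entries change the form by at most `m² δ < μ`; the `+ 1` keeps the
  -- denominator positive for `m = 0`.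
  refine ⟨μ / (2 * (m ^ 2 + 1)), by positivity, fun A hA c hc => ?_⟩
  have hunit : ∀ c : Fin m → ℂ, ‖c‖ = 1 → 0 < (gramForm A c).re := by
    intro c hc
    have h1 : ‖gramForm A c - gramForm G c‖ ≤ m ^ 2 * (μ / (2 * (m ^ 2 + 1))) := by
      unfold gramForm
      simp only [← Finset.sum_sub_distrib, ← mul_sub]
      calc ‖∑ i, ∑ j, starRingEnd ℂ (c i) * c j * (A i j - G i j)‖
          ≤ ∑ i : Fin m, ∑ j : Fin m, μ / (2 * ((m : ℝ) ^ 2 + 1)) := by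
            refine norm_sum_le_of_le _ fun i _ => norm_sum_le_of_le _ fun j _ => ?_
            rw [norm_mul, norm_mul, RCLike.norm_conj]
            have h2 : ‖c i‖ ≤ 1 := hc ▸ norm_le_pi_norm c i
            have h3 : ‖c j‖ ≤ 1 := hc ▸ norm_le_pi_norm c j
            calc ‖c i‖ * ‖c j‖ * ‖A i j - G i j‖ ≤ 1 * 1 * (μ / (2 * ((m : ℝ) ^ 2 + 1))) := by
                  gcongr
                  exact hA i j
              _ = _ := by ring
        _ = m ^ 2 * (μ / (2 * (m ^ 2 + 1))) := by
            simp only [Finset.sum_const, Finset.card_univ, Fintype.card_fin, nsmul_eq_mul]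
            ring
    have h4 : (m : ℝ) ^ 2 * (μ / (2 * (m ^ 2 + 1))) < μ := by
      rw [← mul_div_assoc, div_lt_iff₀ (by positivity)]
      nlinarith [sq_nonneg (m : ℝ)]
    have h5 := (Complex.abs_re_le_norm (gramForm A c - gramForm G c)).trans h1
    rw [Complex.sub_re] at h5
    linarith [hμ c hc, (abs_le.1 h5).1]
  have hn : 0 < ‖c‖ := norm_pos_iff.2 hc
  have h6 := hunit ((‖c‖⁻¹ : ℂ) • c) (by
    rw [norm_smul, norm_inv, Complex.norm_real, norm_norm, inv_mul_cancel₀ hn.ne'])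
  have h7 : gramForm A ((‖c‖⁻¹ : ℂ) • c) = ((‖c‖⁻¹ ^ 2 : ℝ) : ℂ) * gramForm A c := by
    unfold gramForm
    rw [Finset.mul_sum]
    refine Finset.sum_congr rfl fun i _ => ?_
    rw [Finset.mul_sum]
    refine Finset.sum_congr rfl fun j _ => ?_
    simp only [Pi.smul_apply, smul_eq_mul, map_mul, map_inv₀, Complex.conj_ofReal]
    push_cast
    ring
  rw [h7, Complex.re_ofReal_mul] at h6
  exact (mul_pos_iff_of_pos_left (by positivity)).1 h6

/-! ### The lower bound and the index -/

section Index

variable {n : ℕ} {k r α : ℝ} {σ τ : 𝓢'(ℝ, ℂ)} {s : ℝ → ℝ} {h : Dist}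

theorem laplace_sum_smul {m : ℕ} (c : Fin m → ℂ) (f : Fin m → Test) (x : ℝ) :
    laplace (∑ i, c i • f i) x = ∑ i, c i * laplace (f i) x := by
  let L : Test →ₗ[ℂ] ℂ :=
    { toFun := fun f => laplace f x
      map_add' := fun f g => laplace_add f g x
      map_smul' := fun c f => laplace_smul c f x }
  change L (∑ i, c i • f i) = ∑ i, c i * L (f i)
  simp only [map_sum, map_smul, smul_eq_mul]

/-- The sesquilinear expansion is carried out on the transform side: `σ` may be evaluated at any
Schwartz function agreeing with the transform near `[0, ∞)`, so no bilinearity of `laplaceConv` is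
needed. -/
theorem IsSigmaFunction.hankelForm_sum_smul (hσ : IsSigmaFunction h σ) {m : ℕ} (c : Fin m → ℂ)
    (f : Fin m → Test) :
    hankelForm h (∑ i, c i • f i) =
      (gramForm (fun i j => σ (laplaceSchwartz (laplaceConv (conjTest (f i)) (f j)))) c).re := by
  unfold hankelForm gramForm
  rw [hσ _ (∑ i, ∑ j, (starRingEnd ℂ (c i) * c j) •
    laplaceSchwartz (laplaceConv (conjTest (f i)) (f j))) ⟨1, one_pos, fun x hx => ?_⟩]
  · simp only [map_sum, map_smul, smul_eq_mul]
  · rw [laplace_laplaceConv, laplace_conjTest, laplace_sum_smul, map_sum, Finset.sum_mul_sum]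
    simp only [sum_apply, smul_apply, smul_eq_mul]
    refine Finset.sum_congr rfl fun i _ => Finset.sum_congr rfl fun j _ => ?_
    rw [laplaceSchwartz_apply _ hx.le, laplace_laplaceConv, laplace_conjTest, map_mul]
    ring

/-- The condition `2m ≤ n + 2` is what keeps all exponents `i + j` at most `n`, hence below `k`, so
that the limiting moments converge and form a definite matrix. -/
theorem PointSingularity.exists_pos_gram (H : PointSingularity n k r α σ τ s) {m : ℕ}
    (hm : 2 * m ≤ n + 2) :
    ∃ f : Fin m → Test, ∀ c : Fin m → ℂ, c ≠ 0 → 0 < (-1) ^ n *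
      (gramForm (fun i j => σ (laplaceSchwartz (laplaceConv (conjTest (f i)) (f j)))) c).re := by
  have hij : ∀ i j : Fin m, (i + j : ℕ) ≤ n := fun i j => by omega
  let γ : ℝ := (-1) ^ n / Real.Gamma (-k)
  have hγ : γ < 0 := by
    have h1 := neg_one_pow_mul_Gamma_neg_pos n k H.lt_order H.order_lt
    have h2 : γ = -((-1) ^ (n + 1) * Real.Gamma (-k)) / Real.Gamma (-k) ^ 2 := by
      have h3 : Real.Gamma (-k) ≠ 0 := fun h0 => by simp [h0] at h1
      simp only [γ, pow_succ]
      field_simp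
    rw [h2]
    refine div_neg_of_neg_of_pos (by linarith) (sq_pos_of_ne_zero fun h0 => by simp [h0] at h1)
  let G : Fin m → Fin m → ℂ := fun i j => ((γ * moment k (i + j) : ℝ) : ℂ)
  have hG : ∀ c, c ≠ 0 → 0 < (gramForm G c).re := by
    intro c hc
    have h1 := sum_moment_neg (k := k) (fun i j : Fin m =>
      lt_of_le_of_lt (by exact_mod_cast hij i j) H.lt_order) hc
    have h2 : gramForm G c =
        (γ : ℂ) * ∑ i, ∑ j, starRingEnd ℂ (c i) * c j * (moment k (i + j) : ℂ) := by
      unfold gramForm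
      rw [Finset.mul_sum]
      refine Finset.sum_congr rfl fun i _ => ?_
      rw [Finset.mul_sum]
      refine Finset.sum_congr rfl fun j _ => ?_
      simp only [G]
      push_cast
      ring
    rw [h2, Complex.re_ofReal_mul]
    exact mul_pos_of_neg_of_neg hγ h1
  obtain ⟨δ, hδ, hA⟩ := exists_perturbation_pos G hG
  let φ : ℕ → ℝ → 𝓢(ℝ, ℂ) := fun l ε => if hε : 0 < ε then trialProduct r α l ε hε else 0
  have hφ : ∀ l ε (hε : 0 < ε), φ l ε = trialProduct r α l ε hε := fun l ε hε => dif_pos hε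
  have hev : ∀ᶠ ε in 𝓝[>] (0 : ℝ), ∀ l ∈ Finset.range (n + 1),
      ‖((ε ^ k : ℝ) : ℂ) * σ (φ l ε) - ((moment k l / Real.Gamma (-k) : ℝ) : ℂ)‖ < δ / 2 := by
    refine (Finset.eventually_all _).2 fun l hl => ?_
    have h1 := H.tendsto_trialProduct l (by have := Finset.mem_range.1 hl; omega) (φ l) (hφ l)
    have h2 := (Metric.tendsto_nhds.1 h1) (δ / 2) (by positivity)
    simpa only [dist_eq_norm] using h2
  obtain ⟨ε, hε, hε0, hεα⟩ := (hev.and (Ioo_mem_nhdsGT (half_pos H.pos_point))).exists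
  have hεk : 0 < ε ^ k := Real.rpow_pos_of_pos hε0 k
  -- The scale `ε` is fixed first, to be within `δ/2` of the limit matrix; the tolerance `δ/(2 ε^k)`
  -- then becomes the other `δ/2` after multiplication by `ε^k`.
  obtain ⟨f, hf⟩ := H.exists_test_near hε0 (by linarith) m (δ := δ / (2 * ε ^ k)) (by positivity)
  refine ⟨fun i => f i, fun c hc => ?_⟩
  have hsq : ((-1 : ℝ) ^ n) ^ 2 = 1 := by rw [← pow_mul, mul_comm, pow_mul]; simp
  have h3 := hA (fun i j => (((-1) ^ n * ε ^ k : ℝ) : ℂ) *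
    σ (laplaceSchwartz (laplaceConv (conjTest (f i)) (f j)))) (fun i j => ?_) c hc
  · have h4 : gramForm (fun i j : Fin m => (((-1) ^ n * ε ^ k : ℝ) : ℂ) *
        σ (laplaceSchwartz (laplaceConv (conjTest (f i)) (f j)))) c =
        (((-1) ^ n * ε ^ k : ℝ) : ℂ) * gramForm (fun i j : Fin m =>
          σ (laplaceSchwartz (laplaceConv (conjTest (f i)) (f j)))) c := by
      unfold gramForm
      rw [Finset.mul_sum]
      refine Finset.sum_congr rfl fun i _ => ?_
      rw [Finset.mul_sum]
      refine Finset.sum_congr rfl fun j _ => ?_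
      ring
    rw [h4, Complex.re_ofReal_mul, mul_comm ((-1 : ℝ) ^ n), mul_assoc] at h3
    exact (mul_pos_iff_of_pos_left hεk).1 h3
  · have h5 := hε (i + j) (Finset.mem_range.2 (by have := hij i j; omega))
    rw [hφ _ ε hε0] at h5
    have h6 := hf i i.2 j j.2
    have h7 : (((-1) ^ n * ε ^ k : ℝ) : ℂ) *
        σ (laplaceSchwartz (laplaceConv (conjTest (f i)) (f j))) - G i j =
        (((-1) ^ n : ℝ) : ℂ) * (((ε ^ k : ℝ) : ℂ) *
          (σ (laplaceSchwartz (laplaceConv (conjTest (f i)) (f j))) -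
            σ (trialProduct r α (i + j) ε hε0)) +
          (((ε ^ k : ℝ) : ℂ) * σ (trialProduct r α (i + j) ε hε0) -
            ((moment k (i + j) / Real.Gamma (-k) : ℝ) : ℂ))) := by
      simp only [G, γ]
      push_cast
      ring
    have h8 : ‖(((-1) ^ n : ℝ) : ℂ)‖ = 1 := by
      rw [Complex.norm_real, norm_pow, norm_neg, norm_one, one_pow]
    rw [h7, norm_mul, h8, one_mul]
    refine (norm_add_le _ _).trans ?_
    rw [norm_mul, Complex.norm_real, Real.norm_of_nonneg hεk.le]
    have h9 : ε ^ k * ‖σ (laplaceSchwartz (laplaceConv (conjTest (f i)) (f j))) -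
        σ (trialProduct r α (i + j) ε hε0)‖ ≤ ε ^ k * (δ / (2 * ε ^ k)) := by gcongr
    have h10 : ε ^ k * (δ / (2 * ε ^ k)) = δ / 2 := by field_simp
    linarith

/-- The index of the Hankel form with the sign of the leading singularity. -/
theorem PointSingularity.posIndex_eq (H : PointSingularity n k r α σ τ s)
    (hσ : IsSigmaFunction h σ) (hsign : ∀ x, 0 < x → x ≠ α → 0 ≤ (-1) ^ (n + 1) * s x) :
    posIndex (fun f => (-1) ^ n * hankelForm h f) = ((n / 2 + 1 : ℕ) : ℕ∞) := by
  -- For either parity `m = n / 2 + 1` satisfies `n + 1 ≤ 2m ≤ n + 2`, which are the requirements of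
  -- the upper and the lower bound.
  refine le_antisymm (posIndex_le (laplaceJet (n / 2 + 1) α) fun f hf =>
    H.hankelForm_nonpos hσ hsign (by omega) f hf) ?_
  obtain ⟨f, hf⟩ := H.exists_pos_gram (m := n / 2 + 1) (by omega)
  refine le_posIndex (Fintype.linearCombination ℂ f)
    (H.hankelForm_nonpos hσ hsign (m := n / 2 + 1) (by omega) 0 (map_zero _)) fun c hc => ?_
  rw [Fintype.linearCombination_apply, hσ.hankelForm_sum_smul]
  exact hf c hc

end Index

end Hankel

theorem theorem6p9 (n : ℕ) (k r α : ℝ) (hnk : (n : ℝ) < k) (hkn : k < n + 1) (hr : 0 ≤ r)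
    (hα : 0 < α)
    (h : Hankel.Dist) (hreal : Hankel.IsReal h)
    (σ : 𝓢'(ℝ, ℂ)) (hσ : Hankel.IsSigmaFunction h σ)
    (s : ℝ → ℝ) (hs : Hankel.EqFunctionAwayFrom σ s α)
    (hcont : ContinuousOn s (Ioi 0 \ {α}))
    (hzero : s =O[𝓝[>] 0] fun _ => (1 : ℝ))
    (hinfty : s =O[atTop] fun _ => (1 : ℝ))
    (hloc : LocallyIntegrableOn (fun x => (x - α) ^ (n + 1) * s x) (Ioi 0))
    (hsign : ∀ x, 0 < x → x ≠ α → 0 ≤ (-1) ^ (n + 1) * s x)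
    (τ : 𝓢'(ℝ, ℂ)) (hdecomp : ∀ u : 𝓢(ℝ, ℂ), σ u = Hankel.sigmaZero n k r α u + τ u)
    (hτ : Hankel.LessSingular τ n k α) :
    (Even n → Hankel.Nplus h = ((n / 2 + 1 : ℕ) : ℕ∞)) ∧
      (Odd n → Hankel.Nminus h = (((n + 1) / 2 : ℕ) : ℕ∞)) := by
  have H : Hankel.PointSingularity n k r α σ τ s :=
    ⟨hnk, hkn, hr, hα, hs, hcont, hzero, hinfty, hloc, hdecomp, hτ⟩
  have hidx := H.posIndex_eq hσ hsign
  refine ⟨fun hn => ?_, fun hn => ?_⟩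
  · rw [← hidx, Hankel.Nplus]
    simp only [hn.neg_one_pow, one_mul]
  · have hn2 : (n + 1) / 2 = n / 2 + 1 := by
      obtain ⟨l, rfl⟩ := hn
      omega
    rw [hn2, ← hidx, Hankel.Nminus]
    simp only [hn.neg_one_pow, neg_one_mul]
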